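/- Let $c\ge 1$ be an integer and let $M=\mathbb S^2\times\mathbb S^1$ carry the Lorentzian metric $g_c=g_\circ-\frac1{c^2}dt^2$, where $g_\circ$ is the round metric of the unit sphere $\mathbb S^2\subset\mathbb R^3$ and $t\in\mathbb R/2\pi\mathbb Z$ is the angle coordinate on $\mathbb S^1$, time-oriented by $\partial_t$. Let $C^+\subset TM$ be the bundle of future-pointing null vectors, and let $$\mathcal N_c=\{\gamma(J)\mid \gamma\colon J\to M \text{ a maximal geodesic of } g_c \text{ with } \dot\gamma(s)\in C^+ \text{ for all } s\in J\}$$ be the space of null geodesics. For $p\ge1$ let $L(p,1)=\mathbb S^3/\mathbb Z_p$ be the lens space, the quotient manifold of the unit sphere $\mathbb S^3\subset\mathbb C^2$ by the action of $\mathbb Z_p$ generated by $(z_0,z_1)\mapsto(e^{2\pi i/p}z_0,e^{2\pi i/p}z_1)$. Then $\mathcal N_c$ is a smooth ($3$-dimensional, Hausdorff, second countable) manifold, with the quotient structure for which the map $C^+\to\mathcal N_c$ sending a future-pointing null vector to the null geodesic to which it is tangent is a smooth submersion, and, with this structure, $\mathcal N_c$ is diffeomorphic to $L(2c,1)$. 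-/

import Mathlib

open scoped Manifold ContDiff

noncomputable section

/-! ### Pseudo-Riemannian geodesics and null geodesics -/

section General

variable {E : Type*} [NormedAddCommGroup E] [NormedSpace ℝ E]
  {H : Type*} [TopologicalSpace H] (I : ModelWithCorners ℝ E H)
  {M : Type*} [TopologicalSpace M] [ChartedSpace H M]

variable (M) in
/-- A field of bilinear forms on the tangent spaces of `M`, such as a Lorentzian metric. -/
abbrev BilinField : Type _ := ∀ x : M, LinearMap.BilinForm ℝ (TangentSpace I x)

variable {I}

/-- For a manifold `M` without boundary, the bilinear form `g` written in the preferred chart at `x₀`: the pullback of `g` under the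
inverse of this chart, at the point `y` of the model space. -/
def chartMetric (g : BilinField I M) (x₀ : M) (y : E) : LinearMap.BilinForm ℝ E :=
  (g ((extChartAt I x₀).symm y)).compl₁₂
    (mfderiv 𝓘(ℝ, E) I (extChartAt I x₀).symm y).toLinearMap
    (mfderiv 𝓘(ℝ, E) I (extChartAt I x₀).symm y).toLinearMap

/-- The Christoffel symbols of the first kind in the chart at `x₀`, contracted with `u`, `u`, `w`:
`Γ_{l,ij} uⁱ uʲ wˡ` with `Γ_{l,ij} = (∂ᵢ g_{jl} + ∂ⱼ g_{il} - ∂ₗ g_{ij}) / 2`. -/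
def christoffelFirst (g : BilinField I M) (x₀ : M) (y u w : E) : ℝ :=
  fderiv ℝ (fun z => chartMetric g x₀ z u w) y u
    - (1 / 2) * fderiv ℝ (fun z => chartMetric g x₀ z u u) y w

/-- The geodesic equation `g_{lk} ẍᵏ + Γ_{l,ij} ẋⁱ ẋʲ = 0` for the curve `γ` at the time `s`, in the
preferred chart at `γ s` (for nondegenerate `g`, this is `ẍᵏ + Γᵏ_{ij} ẋⁱ ẋʲ = 0`, which does
not depend on the chart). -/
def GeodesicEquationAt (g : BilinField I M) (γ : ℝ → M) (s : ℝ) : Prop :=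
  let x : ℝ → E := fun τ => extChartAt I (γ s) (γ τ)
  ∀ w : E, chartMetric g (γ s) (x s) (deriv (deriv x) s) w
    + christoffelFirst g (γ s) (x s) (deriv x s) w = 0

/-- `γ` restricted to the nonempty open interval `J` is a geodesic. -/
structure IsGeodesicOn (g : BilinField I M) (γ : ℝ → M) (J : Set ℝ) : Prop where
  nonempty : J.Nonempty
  isOpen : IsOpen J
  ordConnected : J.OrdConnected
  smooth : ContMDiffOn 𝓘(ℝ, ℝ) I ∞ γ J
  equation : ∀ s ∈ J, GeodesicEquationAt g γ s

/-- `γ : J → M` is a geodesic that cannot be extended to a larger open interval. -/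
structure IsMaximalGeodesic (g : BilinField I M) (γ : ℝ → M) (J : Set ℝ) : Prop where
  isGeodesicOn : IsGeodesicOn g γ J
  maximal : ∀ (γ' : ℝ → M) (J' : Set ℝ), IsGeodesicOn g γ' J' → J ⊆ J' → Set.EqOn γ γ' J → J' = J

variable (I) in
/-- The velocity of the curve `γ` at the time `s`, as a point of the tangent bundle. -/
def velocity (γ : ℝ → M) (s : ℝ) : TangentBundle I M :=
  ⟨γ s, mfderiv 𝓘(ℝ, ℝ) I γ s (1 : ℝ)⟩

/-- The bundle `C⁺` of future-pointing null vectors, for the time orientation given by the timelike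
vector field `T`. -/
def futureNullCone (g : BilinField I M) (T : ∀ x : M, TangentSpace I x) :
    Set (TangentBundle I M) :=
  {v | v.2 ≠ 0 ∧ g v.1 v.2 v.2 = 0 ∧ g v.1 v.2 (T v.1) < 0}

/-- `γ : J → M` is a maximal geodesic whose velocity is everywhere a future-pointing null vector. -/
def IsMaximalNullGeodesic (g : BilinField I M) (T : ∀ x : M, TangentSpace I x)
    (γ : ℝ → M) (J : Set ℝ) : Prop :=
  IsMaximalGeodesic g γ J ∧ ∀ s ∈ J, velocity I γ s ∈ futureNullCone g T

/-- The space of null geodesics: the images `γ(J)` of the maximal future-pointing null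
geodesics `γ : J → M`. -/
@[ext]
structure NullGeodesicSpace (g : BilinField I M) (T : ∀ x : M, TangentSpace I x) where
  carrier : Set M
  exists_geodesic : ∃ (γ : ℝ → M) (J : Set ℝ), IsMaximalNullGeodesic g T γ J ∧ γ '' J = carrier

/-- The vector `v` is tangent to the null geodesic `n`: it is the velocity, at some time, of a
maximal future-pointing null geodesic with image `n`. -/
def IsTangentTo {g : BilinField I M} {T : ∀ x : M, TangentSpace I x}
    (v : TangentBundle I M) (n : NullGeodesicSpace g T) : Prop :=
  ∃ (γ : ℝ → M) (J : Set ℝ), IsMaximalNullGeodesic g T γ J ∧ γ '' J = n.carrier ∧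
    ∃ s ∈ J, velocity I γ s = v

/-- The given topology and charts make the space of null geodesics a smooth manifold (Hausdorff and
second countable), in such a way that it is the quotient manifold of `C⁺` under the map
`π` that sends a future-pointing null vector to the null geodesic it is tangent to, i.e. `π` is a
smooth submersion on `C⁺`.

Here `C⁺` is an embedded submanifold of the tangent bundle, so that maps from or to `C⁺` are smooth
when they are smooth as maps from a subset of or to the tangent bundle; and a smooth map is a
submersion when it has a smooth local section through every point of its source. The quotient
manifold structure is unique; in particular its topology is the quotient topology. -/
structure IsNullGeodesicManifold [IsManifold I 1 M]
    (g : BilinField I M) (T : ∀ x : M, TangentSpace I x)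
    {F : Type*} [NormedAddCommGroup F] [NormedSpace ℝ F]
    [TopologicalSpace (NullGeodesicSpace g T)] [ChartedSpace F (NullGeodesicSpace g T)] :
    Prop where
  isManifold : IsManifold 𝓘(ℝ, F) ∞ (NullGeodesicSpace g T)
  t2Space : T2Space (NullGeodesicSpace g T)
  secondCountable : SecondCountableTopology (NullGeodesicSpace g T)
  exists_submersion : ∃ π : TangentBundle I M → NullGeodesicSpace g T,
    (∀ v ∈ futureNullCone g T, IsTangentTo v (π v)) ∧
    ContMDiffOn I.tangent 𝓘(ℝ, F) ∞ π (futureNullCone g T) ∧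
    ∀ v ∈ futureNullCone g T, ∃ (U : Set (NullGeodesicSpace g T))
      (σ : NullGeodesicSpace g T → TangentBundle I M),
      IsOpen U ∧ π v ∈ U ∧ ContMDiffOn 𝓘(ℝ, F) I.tangent ∞ σ U ∧ σ (π v) = v ∧
      ∀ n ∈ U, σ n ∈ futureNullCone g T ∧ π (σ n) = n

end General

/-! ### The spacetime `S² × S¹` with the metric `g_∘ - (1/c²) dt²` -/

/-- The unit sphere in `ℝ³`. -/
abbrev S2 : Type := Metric.sphere (0 : EuclideanSpace ℝ (Fin 3)) 1

/-- The round metric on `S²`, induced by the inclusion in `ℝ³`. -/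
def roundMetric : BilinField (𝓡 2) S2 := fun x =>
  (innerₗ (EuclideanSpace ℝ (Fin 3))).compl₁₂
    (mfderiv (𝓡 2) 𝓘(ℝ, EuclideanSpace ℝ (Fin 3))
      ((↑) : S2 → EuclideanSpace ℝ (Fin 3)) x).toLinearMap
    (mfderiv (𝓡 2) 𝓘(ℝ, EuclideanSpace ℝ (Fin 3))
      ((↑) : S2 → EuclideanSpace ℝ (Fin 3)) x).toLinearMap

/-- The differential `dt` of the angle coordinate `t ∈ ℝ / 2πℤ` on the circle: the inner product with
the unit tangent vector `i z` at `z = exp (i t)`. -/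
def angleForm (z : Circle) : TangentSpace (𝓡 1) z →ₗ[ℝ] ℝ :=
  (innerₗ ℂ (Complex.I * (z : ℂ))) ∘ₗ
    (mfderiv (𝓡 1) 𝓘(ℝ, ℂ) (fun w : Circle => (w : ℂ)) z).toLinearMap

/-- The model with corners of `S² × S¹`. -/
abbrev modelS2S1 :
    ModelWithCorners ℝ (EuclideanSpace ℝ (Fin 2) × EuclideanSpace ℝ (Fin 1))
      (ModelProd (EuclideanSpace ℝ (Fin 2)) (EuclideanSpace ℝ (Fin 1))) :=
  (𝓡 2).prod (𝓡 1)

/-- The Lorentzian metric `g_c = g_∘ - (1/c²) dt²` on `S² × S¹`. -/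
def spacetimeMetric (c : ℕ) : BilinField modelS2S1 (S2 × Circle) := fun m =>
  (roundMetric m.1).compl₁₂
      (mfderiv modelS2S1 (𝓡 2) (Prod.fst : S2 × Circle → S2) m).toLinearMap
      (mfderiv modelS2S1 (𝓡 2) (Prod.fst : S2 × Circle → S2) m).toLinearMap
    - (1 / (c : ℝ) ^ 2) • (LinearMap.mul ℝ ℝ).compl₁₂
      (angleForm m.2 ∘ₗ
        (mfderiv modelS2S1 (𝓡 1) (Prod.snd : S2 × Circle → Circle) m).toLinearMap)
      (angleForm m.2 ∘ₗ
        (mfderiv modelS2S1 (𝓡 1) (Prod.snd : S2 × Circle → Circle) m).toLinearMap)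

/-- The vector field `(0, ∂_t)` on `S² × S¹`, which is the choice of future: its value at `(x, z)` is
the velocity at `s = 0` of the curve `s ↦ (x, exp (i s) z)`. -/
def timeField (m : S2 × Circle) : TangentSpace modelS2S1 m :=
  mfderiv 𝓘(ℝ, ℝ) modelS2S1 (fun s : ℝ => ((m.1, Circle.exp s * m.2) : S2 × Circle)) 0 (1 : ℝ)

/-- The space `𝒩_c` of null geodesics of `(S² × S¹, g_c)`. -/
abbrev NullGeodesics (c : ℕ) : Type := NullGeodesicSpace (spacetimeMetric c) timeField

/-! ### Lens spaces -/

/-- The unit sphere in `ℂ²`. -/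
abbrev S3 : Type := Metric.sphere (0 : EuclideanSpace ℂ (Fin 2)) 1

instance fact_finrank_complex_two : Fact (Module.finrank ℝ (EuclideanSpace ℂ (Fin 2)) = 3 + 1) :=
  ⟨by rw [finrank_real_of_complex, finrank_euclideanSpace_fin]⟩

/-- The circle acts on `S³ ⊆ ℂ²` by scalar multiplication. -/
instance circleActionS3 : MulAction Circle S3 where
  smul a x := ⟨(a : ℂ) • (x : EuclideanSpace ℂ (Fin 2)), by simp [norm_smul, Circle.norm_coe]⟩
  one_smul x := Subtype.ext (one_smul ℂ (x : EuclideanSpace ℂ (Fin 2)))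
  mul_smul a b x := Subtype.ext (mul_smul (a : ℂ) (b : ℂ) (x : EuclideanSpace ℂ (Fin 2)))

/-- The cyclic group of order `p` generated by `exp (2πi/p)`. -/
abbrev cyclicGroup (p : ℕ) : Subgroup Circle :=
  Subgroup.zpowers (Circle.exp (2 * Real.pi / p))

instance finite_cyclicGroup (p : ℕ) : Finite (cyclicGroup p) := by
  refine finite_zpowers.2 (isOfFinOrder_iff_pow_eq_one.2 ?_)
  rcases Nat.eq_zero_or_pos p with rfl | hp
  · exact ⟨1, one_pos, by simp⟩
  · refine ⟨p, hp, ?_⟩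
    rw [← Circle.exp_nsmul, nsmul_eq_mul, mul_div_cancel₀ _ (by positivity)]
    exact Circle.exp_two_pi

instance continuousConstSMul_S3 (p : ℕ) : ContinuousConstSMul (cyclicGroup p) S3 where
  continuous_const_smul a := by
    refine Continuous.subtype_mk ?_ _
    exact continuous_subtype_val.const_smul ((a : Circle) : ℂ)

instance isCancelSMul_S3 (p : ℕ) : IsCancelSMul (cyclicGroup p) S3 where
  left_cancel' a x y h := smul_left_cancel a h
  right_cancel' a b x h := by
    have hx : (x : EuclideanSpace ℂ (Fin 2)) ≠ 0 := ne_zero_of_mem_unit_sphere x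
    exact Subtype.ext (Circle.ext (smul_left_injective ℂ hx (congrArg Subtype.val h)))

/-- The lens space `L(p, 1) = S³ / ℤ_p`, where the generator of `ℤ_p` acts by
`(z₀, z₁) ↦ (exp (2πi/p) z₀, exp (2πi/p) z₁)`. It carries the quotient topology, and its charts are
those of `S³` composed with local inverses of the covering `S³ → L(p, 1)`. -/
abbrev LensSpace (p : ℕ) : Type := MulAction.orbitRel.Quotient (cyclicGroup p) S3

theorem contMDiff_smul_S3 (a : Circle) : ContMDiff (𝓡 3) (𝓡 3) ∞ (fun x : S3 => a • x) := by
  have h : ContMDiff (𝓡 3) 𝓘(ℝ, EuclideanSpace ℂ (Fin 2)) ∞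
      (fun x : S3 => (a : ℂ) • (x : EuclideanSpace ℂ (Fin 2))) :=
    ((a : ℂ) • ContinuousLinearMap.id ℝ (EuclideanSpace ℂ (Fin 2))).contMDiff.comp
      (contMDiff_coe_sphere (n := 3))
  exact h.codRestrict_sphere _

instance isManifold_lensSpace (p : ℕ) : IsManifold (𝓡 3) ∞ (LensSpace p) := by
  apply isManifold_of_contDiffOn
  rintro _ _ ⟨q, rfl⟩ ⟨q', rfl⟩
  generalize_proofs hf hs _
  set x := hs.choose q
  set x' := hs.choose q'
  simp only [modelWithCornersSelf_coe, modelWithCornersSelf_coe_symm, Set.range_id, Set.inter_univ,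
    Function.comp_id, Function.id_comp, Set.preimage_id]
  intro u hu
  simp only [OpenPartialHomeomorph.trans_source, OpenPartialHomeomorph.symm_source,
    OpenPartialHomeomorph.trans_symm_eq_symm_trans_symm,
    Set.mem_inter_iff, Set.mem_preimage, OpenPartialHomeomorph.coe_trans, Function.comp_apply,
    IsLocalHomeomorph.localInverseAt_symm] at hu
  obtain ⟨⟨hu1, hu2⟩, hu3, hu4⟩ := hu
  set y : S3 := (chartAt (EuclideanSpace ℝ (Fin 3)) x).symm u with hy
  obtain ⟨a, ha⟩ : ∃ a : cyclicGroup p, a • y = hf.localInverseAt x' (Quotient.mk _ y) :=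
    Quotient.exact (hf.apply_localInverseAt_of_mem hu3)
  have hcont : Continuous (fun w : S3 => a • w) := continuous_const_smul a
  have hev : ∀ᶠ w in nhds y, hf.localInverseAt x' (Quotient.mk _ w) = a • w := by
    have h1 : ∀ᶠ w in nhds y, a • w ∈ (hf.localInverseAt x').target := by
      refine hcont.continuousAt.eventually_mem ((hf.localInverseAt x').open_target.mem_nhds ?_)
      rw [ha]; exact (hf.localInverseAt x').map_source hu3
    filter_upwards [h1] with w hw
    have h2 : (Quotient.mk _ w : LensSpace p) = Quotient.mk _ (a • w) :=
      Quotient.sound ⟨a⁻¹, inv_smul_smul a w⟩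
    rw [h2]
    have := (hf.localInverseAt x').right_inv hw
    rwa [hf.localInverseAt_symm x'] at this
  have hsymm : ContMDiffAt (𝓡 3) (𝓡 3) ∞ (chartAt (EuclideanSpace ℝ (Fin 3)) x).symm u :=
    (contMDiffOn_chart_symm (I := 𝓡 3) (n := ∞) (x := x)).contMDiffAt
      ((chartAt (EuclideanSpace ℝ (Fin 3)) x).open_target.mem_nhds hu1)
  have hchart : ContMDiffAt (𝓡 3) (𝓡 3) ∞ (chartAt (EuclideanSpace ℝ (Fin 3)) x') (a • y) :=
    (contMDiffOn_chart (I := 𝓡 3) (n := ∞) (x := x')).contMDiffAt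
      ((chartAt (EuclideanSpace ℝ (Fin 3)) x').open_source.mem_nhds (by rw [ha]; exact hu4))
  have hcomp : ContMDiffAt (𝓡 3) (𝓡 3) ∞ (fun v => chartAt (EuclideanSpace ℝ (Fin 3)) x'
      (a • (chartAt (EuclideanSpace ℝ (Fin 3)) x).symm v)) u :=
    ContMDiffAt.comp u hchart
      (ContMDiffAt.comp u (contMDiff_smul_S3 (a : Circle)).contMDiffAt hsymm)
  refine (contMDiffAt_iff_contDiffAt.1 (hcomp.congr_of_eventuallyEq ?_)).contDiffWithinAt
  filter_upwards [hsymm.continuousAt.eventually hev] with v hv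
  simp only [OpenPartialHomeomorph.coe_trans, Function.comp_apply,
    OpenPartialHomeomorph.trans_symm_eq_symm_trans_symm, IsLocalHomeomorph.localInverseAt_symm]
  rw [hv]

end

/-! The spacetime sits in `ℝ³ × ℂ`, and `g_c` is the restriction of the constant form `|a|² -
|α|²/c²`. For a metric induced by a constant form, a curve is a geodesic exactly when its ambient
acceleration pairs to zero with all tangent vectors (`geodesicEquationAt_iff_acceleration`). Here
this splits into one condition on each sphere factor, so both components run along great circles at
constant speed. Nullness makes the speed on `S¹` equal to `c` times the speed on `S²`, so the future
null geodesics are `s ↦ (cos (ks) a + sin (ks) b, exp (icks) z)` with `a`, `b` orthonormal and `k >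
0` (`eq_nullCurve_of_isMaximalNullGeodesic`).

Orthonormal pairs in `ℝ³` are unit spinors `y ∈ S³` up to sign, and multiplying `y` by a unit `u`
turns the pair by the angle of `u²`. With `u = exp (iks/2)` the geodesic becomes `u ↦ (spherePoint
(u • y), u ^ (2c) z)`. Its image is unchanged when `(y, z)` is replaced by `(u • y, u ^ (2c) z)`;
hence `z = 1` can be arranged, and what remains is the action of the `2c`-th roots of unity on `y`.
The sign ambiguity of the spinor is absorbed because `2c` is even. This gives the bijection
`lensEquiv` with `L(2c, 1)`.

For smoothness, `C⁺ → L(2c, 1)` must lift locally to `S³`. The spinor of a null vector is known only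
up to sign, but the products `yᵢ yⱼ` are explicit functions of the vector, and a branch of the
`2c`-th root near `1` then normalizes the spinor (`contMDiffOn_lensEquiv_symm_comp`). In the other
direction `y ↦ nullVector c y z k` is smooth. Together with local sections of `S³ → L(2c, 1)`, this
shows that the structure carried over from the lens space is a quotient structure, and that every
quotient structure is diffeomorphic to it. -/

noncomputable section

open scoped Manifold ContDiff Topology InnerProductSpace
open Set Filter

/-! ### Geodesics of a metric induced from a vector space -/

section Pullback

variable {E V : Type*} [NormedAddCommGroup E] [NormedSpace ℝ E]
  [NormedAddCommGroup V] [NormedSpace ℝ V]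

/-- The second derivative of a composition `F ∘ x` with a curve `x`. -/
theorem deriv_deriv_comp_curve {F : E → V} {x : ℝ → E} {s : ℝ}
    (hF : ContDiffAt ℝ ∞ F (x s)) (hx : ContDiffAt ℝ ∞ x s) :
    deriv (deriv (F ∘ x)) s = fderiv ℝ (fderiv ℝ F) (x s) (deriv x s) (deriv x s)
      + fderiv ℝ F (x s) (deriv (deriv x) s) := by
  have h1 : deriv (F ∘ x) =ᶠ[𝓝 s] fun τ => fderiv ℝ F (x τ) (deriv x τ) := by
    filter_upwards [hx.continuousAt.eventually ((hF.of_le (m := 1) (by simp)).eventually (by simp)),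
      (hx.of_le (m := 1) (by simp)).eventually (by simp)] with τ h2 h3
    exact fderiv_comp_deriv τ (h2.differentiableAt (by simp)) (h3.differentiableAt (by simp))
  rw [h1.deriv_eq]
  have h2 : DifferentiableAt ℝ (fderiv ℝ F) (x s) :=
    (hF.fderiv_right (m := 1) (WithTop.coe_le_coe.2 le_top)).differentiableAt (by simp)
  have h3 : HasDerivAt x (deriv x s) s := (hx.differentiableAt (by simp)).hasDerivAt
  have h4 : HasDerivAt (deriv x) (deriv (deriv x) s) s := by
    have : ContDiffAt ℝ 1 (deriv x) s := by
      have := (hx.fderiv_right (m := 1) (WithTop.coe_le_coe.2 le_top)).clm_apply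
        (contDiffAt_const (c := (1 : ℝ)))
      exact this
    exact (this.differentiableAt (by simp)).hasDerivAt
  exact ((h2.hasFDerivAt.comp_hasDerivAt s h3).clm_apply h4).deriv

theorem fderiv_bilin_fderiv_fderiv {F : E → V} {y : E} (hF : ContDiffAt ℝ ∞ F y)
    (B : V →L[ℝ] V →L[ℝ] ℝ) (u w a : E) :
    fderiv ℝ (fun z => B (fderiv ℝ F z u) (fderiv ℝ F z w)) y a
      = B (fderiv ℝ (fderiv ℝ F) y a u) (fderiv ℝ F y w)
        + B (fderiv ℝ F y u) (fderiv ℝ (fderiv ℝ F) y a w) := by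
  have h2 : DifferentiableAt ℝ (fderiv ℝ F) y :=
    (hF.fderiv_right (m := 1) (WithTop.coe_le_coe.2 le_top)).differentiableAt (by simp)
  have h3 : ∀ v : E, HasFDerivAt (fun z => fderiv ℝ F z v)
      ((fderiv ℝ (fderiv ℝ F) y).flip v) y := fun v => by
    simpa using h2.hasFDerivAt.clm_apply (hasFDerivAt_const v y)
  have h4 := (B.hasFDerivAt.comp y (h3 u)).clm_apply (h3 w)
  refine (congrArg (fun L => L a) h4.fderiv).trans ?_
  simp [add_comm]

/-- For the metric `F^* B` on a vector space, the left hand side of the geodesic equation is the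
pairing with the acceleration of `F ∘ x`. -/
theorem geodesic_expression_pullback {F : E → V} {x : ℝ → E} {s : ℝ}
    (hF : ContDiffAt ℝ ∞ F (x s)) (hx : ContDiffAt ℝ ∞ x s)
    (B : V →L[ℝ] V →L[ℝ] ℝ) (hB : ∀ a b, B a b = B b a) (w : E) :
    B (fderiv ℝ F (x s) (deriv (deriv x) s)) (fderiv ℝ F (x s) w)
      + (fderiv ℝ (fun z => B (fderiv ℝ F z (deriv x s)) (fderiv ℝ F z w)) (x s) (deriv x s)
        - (1 / 2) * fderiv ℝ (fun z => B (fderiv ℝ F z (deriv x s)) (fderiv ℝ F z (deriv x s)))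
          (x s) w)
      = B (deriv (deriv (F ∘ x)) s) (fderiv ℝ F (x s) w) := by
  rw [fderiv_bilin_fderiv_fderiv hF, fderiv_bilin_fderiv_fderiv hF, deriv_deriv_comp_curve hF hx]
  -- By symmetry of `D²F` and of `B`, the terms pairing `DF u` with `D²F (u, w)` cancel, where `u`
  -- is the velocity. Only `D²F (u, u)` paired with `DF w` survives, and it completes `DF ẍ` to the
  -- acceleration of `F ∘ x`.
  have hs : fderiv ℝ (fderiv ℝ F) (x s) w (deriv x s)
      = fderiv ℝ (fderiv ℝ F) (x s) (deriv x s) w :=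
    (hF.isSymmSndFDerivAt
      (by simpa using (WithTop.coe_le_coe.2 le_top : (2 : WithTop ℕ∞) ≤ ∞))).eq _ _
  rw [hs, hB (fderiv ℝ (fderiv ℝ F) (x s) (deriv x s) w)]
  simp only [map_add, _root_.add_apply]
  ring

variable {H : Type*} [TopologicalSpace H] {I : ModelWithCorners ℝ E H}
  {M : Type*} [TopologicalSpace M] [ChartedSpace H M]

/-- A curve is a geodesic of a metric induced by a map to a vector space if and only if its
acceleration in the vector space is orthogonal to the tangent spaces. -/
theorem geodesicEquationAt_iff_acceleration [I.Boundaryless] [IsManifold I ∞ M]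
    {ι : M → V} (hι : ContMDiff I 𝓘(ℝ, V) ∞ ι)
    (B : V →L[ℝ] V →L[ℝ] ℝ) (hB : ∀ a b, B a b = B b a) {g : BilinField I M}
    (hg : ∀ m u w, g m u w = B (mvfderiv I ι m u) (mvfderiv I ι m w))
    {γ : ℝ → M} {s : ℝ} (hγ : ContMDiffAt 𝓘(ℝ, ℝ) I ∞ γ s) :
    GeodesicEquationAt g γ s ↔
      ∀ w : TangentSpace I (γ s), B (deriv (deriv (ι ∘ γ)) s) (mvfderiv I ι (γ s) w) = 0 := by
  have : IsManifold I 1 M := IsManifold.of_le (n := ∞) (by simp)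
  set e := extChartAt I (γ s) with he
  set x : ℝ → E := fun τ => e (γ τ) with hxdef
  set F : E → V := ι ∘ e.symm with hFdef
  have hx : ContDiffAt ℝ ∞ x s := by
    rw [← contMDiffAt_iff_contDiffAt]
    exact ContMDiffAt.comp s (contMDiffAt_extChartAt (n := ∞)) hγ
  have htgt : ∀ y ∈ e.target, e.target ∈ 𝓝 y := fun y hy =>
    (isOpen_extChartAt_target (γ s)).mem_nhds hy
  have hsymm : ∀ y ∈ e.target, ContMDiffAt 𝓘(ℝ, E) I ∞ e.symm y := fun y hy =>
    (contMDiffOn_extChartAt_symm (γ s)).contMDiffAt (htgt y hy)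
  have hxs : x s ∈ e.target := mem_extChartAt_target (γ s)
  have hF : ∀ y ∈ e.target, ContDiffAt ℝ ∞ F y := fun y hy => by
    rw [← contMDiffAt_iff_contDiffAt]
    exact ContMDiffAt.comp y hι.contMDiffAt (hsymm y hy)
  have hDF : ∀ y ∈ e.target, ∀ u : E, mvfderiv I ι (e.symm y) (mfderiv 𝓘(ℝ, E) I e.symm y u)
      = fderiv ℝ F y u := fun y hy u => by
    have h1 := mfderiv_comp (I := 𝓘(ℝ, E)) (I' := I) (I'' := 𝓘(ℝ, V)) y
      (hι.mdifferentiable (by simp) (e.symm y)) ((hsymm y hy).mdifferentiableAt (by simp))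
    rw [mfderiv_eq_fderiv] at h1
    exact (congrArg (fun L => L u) h1).symm
  have hmet : ∀ y ∈ e.target, ∀ u w : E,
      chartMetric g (γ s) y u w = B (fderiv ℝ F y u) (fderiv ℝ F y w) := fun y hy u w => by
    rw [← hDF y hy, ← hDF y hy]
    exact hg _ _ _
  have hmet' : ∀ u w : E, (fun z => chartMetric g (γ s) z u w) =ᶠ[𝓝 (x s)]
      fun z => B (fderiv ℝ F z u) (fderiv ℝ F z w) := fun u w => by
    filter_upwards [htgt _ hxs] with z hz using hmet z hz u w
  have hcomp : F ∘ x =ᶠ[𝓝 s] ι ∘ γ := by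
    filter_upwards [hγ.continuousAt.eventually_mem (extChartAt_source_mem_nhds (I := I) (γ s))]
      with τ hτ
    simp only [hFdef, hxdef, Function.comp_apply]
    rw [e.left_inv hτ]
  have hinv : (mfderiv 𝓘(ℝ, E) I e.symm (x s)).IsInvertible := by
    have := isInvertible_mfderivWithin_extChartAt_symm (I := I) (x := γ s) hxs
    rwa [I.range_eq_univ, mfderivWithin_univ] at this
  have hes : e.symm (x s) = γ s := extChartAt_to_inv (γ s)
  have key : GeodesicEquationAt g γ s ↔
      ∀ w : E, B (deriv (deriv (ι ∘ γ)) s) (fderiv ℝ F (x s) w) = 0 := by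
    have h2 : deriv (deriv (ι ∘ γ)) s = deriv (deriv (F ∘ x)) s :=
      (hcomp.deriv.deriv_eq).symm
    rw [h2]
    refine forall_congr' fun w => ?_
    rw [← geodesic_expression_pullback (hF _ hxs) hx B hB w]
    change chartMetric g (γ s) (x s) (deriv (deriv x) s) w
      + christoffelFirst g (γ s) (x s) (deriv x s) w = 0 ↔ _
    rw [christoffelFirst, hmet _ hxs, (hmet' _ _).fderiv_eq, (hmet' _ _).fderiv_eq]
  rw [key]
  -- The inverse chart has invertible differential, so the vectors `DF w` are exactly the images
  -- under `dι` of the tangent vectors at `γ s`.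
  obtain ⟨L, hL⟩ := hinv
  constructor
  · intro h w
    have h3 : ∀ w : TangentSpace I (e.symm (x s)),
        B (deriv (deriv (ι ∘ γ)) s) (mvfderiv I ι (e.symm (x s)) w) = 0 := fun w => by
      have h4 := hDF _ hxs (L.symm w)
      rw [← hL] at h4
      have h5 : L (L.symm w) = w := L.apply_symm_apply w
      rw [← h5]
      exact (congrArg _ h4).trans (h (L.symm w))
    rw [hes] at h3
    exact h3 w
  · intro h w
    rw [← hDF _ hxs]
    have h3 : ∀ w : TangentSpace I (e.symm (x s)),
        B (deriv (deriv (ι ∘ γ)) s) (mvfderiv I ι (e.symm (x s)) w) = 0 := by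
      rw [hes]; exact h
    exact h3 _

end Pullback

/-! ### The spacetime as a submanifold of `ℝ³ × ℂ` -/

section Embedding

/-- The inclusion of `S² × S¹` in `ℝ³ × ℂ`. -/
def spacetimeEmbedding (m : S2 × Circle) : EuclideanSpace ℝ (Fin 3) × ℂ := (m.1, m.2)

/-- The quadratic form `|a|² - |α|² / c²` on `ℝ³ × ℂ`, which induces the metric `g_c`. -/
def ambientForm (c : ℕ) :
    (EuclideanSpace ℝ (Fin 3) × ℂ) →L[ℝ] (EuclideanSpace ℝ (Fin 3) × ℂ) →L[ℝ] ℝ :=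
  (innerSL ℝ).bilinearComp (.fst ℝ _ _) (.fst ℝ _ _)
    - (1 / (c : ℝ) ^ 2) • (innerSL ℝ).bilinearComp (.snd ℝ _ _) (.snd ℝ _ _)

theorem ambientForm_apply (c : ℕ) (a b : EuclideanSpace ℝ (Fin 3) × ℂ) :
    ambientForm c a b = ⟪a.1, b.1⟫_ℝ - 1 / (c : ℝ) ^ 2 * ⟪a.2, b.2⟫_ℝ := by
  simp [ambientForm]

theorem ambientForm_comm (c : ℕ) (a b : EuclideanSpace ℝ (Fin 3) × ℂ) :
    ambientForm c a b = ambientForm c b a := by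
  simp only [ambientForm_apply, real_inner_comm]

theorem contMDiff_coe_S2 :
    ContMDiff (𝓡 2) 𝓘(ℝ, EuclideanSpace ℝ (Fin 3)) ∞ ((↑) : S2 → EuclideanSpace ℝ (Fin 3)) :=
  have := Fact.mk (@finrank_euclideanSpace_fin ℝ _ (2 + 1))
  contMDiff_coe_sphere

theorem contMDiff_coe_circle : ContMDiff (𝓡 1) 𝓘(ℝ, ℂ) ∞ (fun w : Circle => (w : ℂ)) :=
  have := finrank_real_complex_fact'
  contMDiff_coe_sphere (E := ℂ) (n := 1)

theorem range_mvfderiv_coe_S2 (p : S2) :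
    (mvfderiv (𝓡 2) ((↑) : S2 → EuclideanSpace ℝ (Fin 3)) p).range
      = (ℝ ∙ (p : EuclideanSpace ℝ (Fin 3)))ᗮ :=
  have := Fact.mk (@finrank_euclideanSpace_fin ℝ _ (2 + 1))
  range_mvfderiv_subtypeVal p

theorem range_mvfderiv_coe_circle (z : Circle) :
    (mvfderiv (𝓡 1) (fun w : Circle => (w : ℂ)) z).range = (ℝ ∙ (z : ℂ))ᗮ :=
  have := finrank_real_complex_fact'
  range_mvfderiv_subtypeVal (E := ℂ) (n := 1) z

theorem injective_mvfderiv_coe_S2 (p : S2) :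
    Function.Injective (mvfderiv (𝓡 2) ((↑) : S2 → EuclideanSpace ℝ (Fin 3)) p) :=
  have := Fact.mk (@finrank_euclideanSpace_fin ℝ _ (2 + 1))
  injective_mvfderiv_subtypeVal_sphere p

theorem injective_mvfderiv_coe_circle (z : Circle) :
    Function.Injective (mvfderiv (𝓡 1) (fun w : Circle => (w : ℂ)) z) :=
  have := finrank_real_complex_fact'
  injective_mvfderiv_subtypeVal_sphere (E := ℂ) (n := 1) z

theorem contMDiff_spacetimeEmbedding :
    ContMDiff modelS2S1 𝓘(ℝ, EuclideanSpace ℝ (Fin 3) × ℂ) ∞ spacetimeEmbedding :=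
  (contMDiff_coe_S2.comp contMDiff_fst).prodMk_space (contMDiff_coe_circle.comp contMDiff_snd)

/-- The differential of a vector valued function commutes with continuous linear maps. -/
theorem mvfderiv_clm_comp {E H M V W : Type*} [NormedAddCommGroup E] [NormedSpace ℝ E]
    [TopologicalSpace H] {I : ModelWithCorners ℝ E H} [TopologicalSpace M] [ChartedSpace H M]
    [NormedAddCommGroup V] [NormedSpace ℝ V] [NormedAddCommGroup W] [NormedSpace ℝ W]
    {f : M → V} {m : M} (hf : MDifferentiableAt I 𝓘(ℝ, V) f m) (L : V →L[ℝ] W)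
    (w : TangentSpace I m) :
    mvfderiv I (L ∘ f) m w = L (mvfderiv I f m w) := by
  have h := mfderiv_comp (I' := 𝓘(ℝ, V)) (I'' := 𝓘(ℝ, W)) m L.mdifferentiableAt hf
  rw [L.mfderiv_eq] at h
  exact congrArg (fun T => T w) h

/-- The chain rule for a vector valued function along a curve. -/
theorem mvfderiv_mfderiv_curve {E H M V : Type*} [NormedAddCommGroup E] [NormedSpace ℝ E]
    [TopologicalSpace H] {I : ModelWithCorners ℝ E H} [TopologicalSpace M] [ChartedSpace H M]
    [NormedAddCommGroup V] [NormedSpace ℝ V] {f : M → V} {γ : ℝ → M} {s : ℝ}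
    (hf : MDifferentiableAt I 𝓘(ℝ, V) f (γ s)) (hγ : MDifferentiableAt 𝓘(ℝ, ℝ) I γ s) :
    mvfderiv I f (γ s) (mfderiv 𝓘(ℝ, ℝ) I γ s (1 : ℝ)) = deriv (f ∘ γ) s := by
  have h := mfderiv_comp (I := 𝓘(ℝ, ℝ)) (I' := I) (I'' := 𝓘(ℝ, V)) s hf hγ
  rw [mfderiv_eq_fderiv] at h
  exact (congrArg (fun T => T (1 : ℝ)) h).symm

/-- The differential of the inclusion of `S² × S¹`, in components. -/
theorem mvfderiv_spacetimeEmbedding (m : S2 × Circle) (w : TangentSpace modelS2S1 m) :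
    mvfderiv modelS2S1 spacetimeEmbedding m w
      = (mvfderiv (𝓡 2) ((↑) : S2 → EuclideanSpace ℝ (Fin 3)) m.1
          (mfderiv modelS2S1 (𝓡 2) (Prod.fst : S2 × Circle → S2) m w),
        mvfderiv (𝓡 1) (fun w : Circle => (w : ℂ)) m.2
          (mfderiv modelS2S1 (𝓡 1) (Prod.snd : S2 × Circle → Circle) m w)) := by
  have h0 : MDifferentiableAt modelS2S1 𝓘(ℝ, EuclideanSpace ℝ (Fin 3) × ℂ) spacetimeEmbedding m :=
    contMDiff_spacetimeEmbedding.mdifferentiable (by simp) m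
  refine Prod.ext ?_ ?_
  · have h1 := mvfderiv_clm_comp h0 (.fst ℝ (EuclideanSpace ℝ (Fin 3)) ℂ) w
    refine h1.symm.trans ?_
    exact congrArg (fun T => T w) (mfderiv_comp (I := modelS2S1) (I' := 𝓡 2) m
      (contMDiff_coe_S2.mdifferentiable (by simp) m.1) mdifferentiableAt_fst)
  · have h1 := mvfderiv_clm_comp h0 (.snd ℝ (EuclideanSpace ℝ (Fin 3)) ℂ) w
    refine h1.symm.trans ?_
    exact congrArg (fun T => T w) (mfderiv_comp (I := modelS2S1) (I' := 𝓡 1) m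
      (contMDiff_coe_circle.mdifferentiable (by simp) m.2) mdifferentiableAt_snd)

theorem mvfderiv_spacetimeEmbedding_fst_orthogonal (m : S2 × Circle)
    (w : TangentSpace modelS2S1 m) :
    ⟪(m.1 : EuclideanSpace ℝ (Fin 3)), (mvfderiv modelS2S1 spacetimeEmbedding m w).1⟫_ℝ = 0 := by
  rw [mvfderiv_spacetimeEmbedding]
  rw [← Submodule.mem_orthogonal_singleton_iff_inner_right, ← range_mvfderiv_coe_S2]
  exact LinearMap.mem_range_self _ _

theorem mvfderiv_spacetimeEmbedding_snd_orthogonal (m : S2 × Circle)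
    (w : TangentSpace modelS2S1 m) :
    ⟪(m.2 : ℂ), (mvfderiv modelS2S1 spacetimeEmbedding m w).2⟫_ℝ = 0 := by
  rw [mvfderiv_spacetimeEmbedding]
  rw [← Submodule.mem_orthogonal_singleton_iff_inner_right, ← range_mvfderiv_coe_circle]
  exact LinearMap.mem_range_self _ _

/-- The two components of a tangent vector can be prescribed independently. Taking one of them zero
is what splits the geodesic equation into a condition on each factor. -/
theorem exists_mvfderiv_spacetimeEmbedding_eq (m : S2 × Circle) {a : EuclideanSpace ℝ (Fin 3)}
    {α : ℂ} (ha : ⟪(m.1 : EuclideanSpace ℝ (Fin 3)), a⟫_ℝ = 0) (hα : ⟪(m.2 : ℂ), α⟫_ℝ = 0) :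
    ∃ w : TangentSpace modelS2S1 m, mvfderiv modelS2S1 spacetimeEmbedding m w = (a, α) := by
  rw [← Submodule.mem_orthogonal_singleton_iff_inner_right, ← range_mvfderiv_coe_S2] at ha
  rw [← Submodule.mem_orthogonal_singleton_iff_inner_right, ← range_mvfderiv_coe_circle] at hα
  obtain ⟨u, rfl⟩ := ha
  obtain ⟨v, rfl⟩ := hα
  refine ⟨(u, v), (mvfderiv_spacetimeEmbedding m _).trans ?_⟩
  rw [mfderiv_fst, mfderiv_snd]
  rfl

theorem injective_mvfderiv_spacetimeEmbedding (m : S2 × Circle) :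
    Function.Injective (mvfderiv modelS2S1 spacetimeEmbedding m) := by
  intro u w h
  rw [mvfderiv_spacetimeEmbedding, mvfderiv_spacetimeEmbedding, mfderiv_fst, mfderiv_snd] at h
  obtain ⟨h1, h2⟩ := Prod.mk.inj h
  exact Prod.ext (injective_mvfderiv_coe_S2 _ h1) (injective_mvfderiv_coe_circle _ h2)

/-- A vector orthogonal to `z` is a real multiple of the unit vector `i z`. This turns the square of
`dt` into the inner product of `ℂ`. -/
theorem inner_I_mul_mul_inner_I_mul {z α β : ℂ} (hz : ‖z‖ = 1) (hα : ⟪z, α⟫_ℝ = 0) :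
    ⟪Complex.I * z, α⟫_ℝ * ⟪Complex.I * z, β⟫_ℝ = ⟪α, β⟫_ℝ := by
  have hz' : z.re * z.re + z.im * z.im = 1 := by
    rw [← Complex.normSq_apply, Complex.normSq_eq_norm_sq, hz, one_pow]
  simp only [Complex.inner, Complex.mul_re, Complex.mul_im, Complex.conj_re, Complex.conj_im,
    Complex.I_re, Complex.I_im] at *
  linear_combination (α.re * β.re + α.im * β.im) * hz' - (z.re * β.re + z.im * β.im) * hα

/-- The metric `g_c` is induced by the inclusion of `S² × S¹` in `ℝ³ × ℂ`. -/
theorem spacetimeMetric_apply (c : ℕ) (m : S2 × Circle) (u w : TangentSpace modelS2S1 m) :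
    spacetimeMetric c m u w = ambientForm c (mvfderiv modelS2S1 spacetimeEmbedding m u)
      (mvfderiv modelS2S1 spacetimeEmbedding m w) := by
  rw [ambientForm_apply, ← inner_I_mul_mul_inner_I_mul (Circle.norm_coe m.2)
    (mvfderiv_spacetimeEmbedding_snd_orthogonal m u), mvfderiv_spacetimeEmbedding,
    mvfderiv_spacetimeEmbedding]
  rfl

theorem contMDiff_circle_translate (m : S2 × Circle) :
    ContMDiff 𝓘(ℝ, ℝ) modelS2S1 ∞ (fun s : ℝ => ((m.1, Circle.exp s * m.2) : S2 × Circle)) :=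
  contMDiff_const.prodMk ((contMDiff_circleExp (m := ∞)).mul contMDiff_const)

theorem mvfderiv_timeField (m : S2 × Circle) :
    mvfderiv modelS2S1 spacetimeEmbedding m (timeField m) = (0, Complex.I * m.2) := by
  have h := mvfderiv_mfderiv_curve (I := modelS2S1) (s := 0) (f := spacetimeEmbedding)
    (contMDiff_spacetimeEmbedding.mdifferentiable (by simp) _)
    ((contMDiff_circle_translate m).mdifferentiable (by simp) 0)
  have h2 : HasDerivAt (spacetimeEmbedding ∘ fun s : ℝ => ((m.1, Circle.exp s * m.2) : S2 × Circle))
      (0, Complex.I * m.2) 0 := by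
    refine HasDerivAt.prodMk (hasDerivAt_const (0 : ℝ) (m.1 : EuclideanSpace ℝ (Fin 3))) ?_
    simp only [Circle.coe_mul, Circle.coe_exp]
    have h3 : HasDerivAt (fun s : ℝ => Complex.exp (s * Complex.I)) Complex.I 0 := by
      have := ((hasDerivAt_id (0 : ℝ)).ofReal_comp.mul_const Complex.I).cexp
      simpa using this
    exact h3.mul_const _
  rw [h2.deriv] at h
  -- The curve defining `timeField m` starts at `(m.1, exp 0 * m.2)`, which equals `m` but not
  -- definitionally, so the base point has to be changed.
  have h4 : ∀ (m' : S2 × Circle), m' = m →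
      ∀ w : EuclideanSpace ℝ (Fin 2) × EuclideanSpace ℝ (Fin 1),
        mvfderiv modelS2S1 spacetimeEmbedding m' w = mvfderiv modelS2S1 spacetimeEmbedding m w := by
    rintro _ rfl _
    rfl
  exact (h4 _ (by simp) _).symm.trans h

theorem mvfderiv_velocity {γ : ℝ → S2 × Circle} {s : ℝ}
    (hγ : ContMDiffAt 𝓘(ℝ, ℝ) modelS2S1 ∞ γ s) :
    mvfderiv modelS2S1 spacetimeEmbedding (γ s) (velocity modelS2S1 γ s).2
      = deriv (spacetimeEmbedding ∘ γ) s :=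
  mvfderiv_mfderiv_curve (contMDiff_spacetimeEmbedding.mdifferentiable (by simp) _)
    (hγ.mdifferentiableAt (by simp))

/-- The future null cone in terms of the ambient space `ℝ³ × ℂ`. -/
theorem mem_futureNullCone_iff {c : ℕ} (hc : 1 ≤ c) (v : TangentBundle modelS2S1 (S2 × Circle)) :
    v ∈ futureNullCone (spacetimeMetric c) timeField ↔
      ‖(mvfderiv modelS2S1 spacetimeEmbedding v.1 v.2).1‖ * c
          = ⟪Complex.I * v.1.2, (mvfderiv modelS2S1 spacetimeEmbedding v.1 v.2).2⟫_ℝ ∧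
        0 < ⟪Complex.I * v.1.2, (mvfderiv modelS2S1 spacetimeEmbedding v.1 v.2).2⟫_ℝ := by
  have hc' : (0 : ℝ) < c := by exact_mod_cast hc
  have horth := mvfderiv_spacetimeEmbedding_snd_orthogonal v.1 v.2
  have hsq := inner_I_mul_mul_inner_I_mul
    (β := (mvfderiv modelS2S1 spacetimeEmbedding v.1 v.2).2) (Circle.norm_coe v.1.2) horth
  change (v.2 ≠ 0 ∧ spacetimeMetric c v.1 v.2 v.2 = 0
    ∧ spacetimeMetric c v.1 v.2 (timeField v.1) < 0) ↔ _
  rw [spacetimeMetric_apply, spacetimeMetric_apply, mvfderiv_timeField, ambientForm_apply,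
    ambientForm_apply, ← hsq]
  simp only [inner_zero_right, zero_sub, real_inner_self_eq_norm_sq]
  rw [real_inner_comm (Complex.I * (v.1.2 : ℂ))]
  generalize hθ : ⟪Complex.I * (v.1.2 : ℂ), (mvfderiv modelS2S1 spacetimeEmbedding v.1 v.2).2⟫_ℝ = θ
  generalize ha : ‖(mvfderiv modelS2S1 spacetimeEmbedding v.1 v.2).1‖ = a
  have ha0 : 0 ≤ a := ha ▸ norm_nonneg _
  have h1 : a ^ 2 - 1 / (c : ℝ) ^ 2 * (θ * θ) = 0 ↔ (a * c) ^ 2 = θ ^ 2 := by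
    field_simp
    rw [mul_zero, sub_eq_zero]
  have h2 : -(1 / (c : ℝ) ^ 2 * θ) < 0 ↔ 0 < θ := by
    rw [neg_lt_zero]
    exact mul_pos_iff_of_pos_left (by positivity)
  rw [h1, h2]
  constructor
  · rintro ⟨-, h3, h4⟩
    exact ⟨(sq_eq_sq₀ (by positivity) h4.le).1 h3, h4⟩
  · rintro ⟨h3, h4⟩
    refine ⟨?_, by rw [h3], h4⟩
    intro h5
    rw [h5] at hθ
    simp at hθ
    exact h4.ne hθ

/-- The geodesic equation of `g_c` in terms of the ambient space: the acceleration is normal. -/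
theorem geodesicEquationAt_spacetimeMetric_iff {c : ℕ} (hc : 1 ≤ c) {γ : ℝ → S2 × Circle} {s : ℝ}
    (hγ : ContMDiffAt 𝓘(ℝ, ℝ) modelS2S1 ∞ γ s) :
    GeodesicEquationAt (spacetimeMetric c) γ s ↔
      (∀ a : EuclideanSpace ℝ (Fin 3), ⟪((γ s).1 : EuclideanSpace ℝ (Fin 3)), a⟫_ℝ = 0 →
        ⟪(deriv (deriv (spacetimeEmbedding ∘ γ)) s).1, a⟫_ℝ = 0) ∧
      ∀ α : ℂ, ⟪((γ s).2 : ℂ), α⟫_ℝ = 0 →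
        ⟪(deriv (deriv (spacetimeEmbedding ∘ γ)) s).2, α⟫_ℝ = 0 := by
  have hc' : (0 : ℝ) < c := by exact_mod_cast hc
  rw [geodesicEquationAt_iff_acceleration contMDiff_spacetimeEmbedding (ambientForm c)
    (ambientForm_comm c) (spacetimeMetric_apply c) hγ]
  simp only [ambientForm_apply]
  constructor
  · intro h
    constructor
    · intro a ha
      obtain ⟨w, hw⟩ := exists_mvfderiv_spacetimeEmbedding_eq (γ s) ha (inner_zero_right _)
      simpa [hw] using h w
    · intro α hα
      obtain ⟨w, hw⟩ := exists_mvfderiv_spacetimeEmbedding_eq (γ s) (inner_zero_right _) hα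
      have := h w
      rw [hw] at this
      simpa [hc'.ne'] using this
  · rintro ⟨h1, h2⟩ w
    rw [h1 _ (mvfderiv_spacetimeEmbedding_fst_orthogonal _ w),
      h2 _ (mvfderiv_spacetimeEmbedding_snd_orthogonal _ w)]
    simp

end Embedding

/-! ### Curves on a unit sphere with normal acceleration -/

section GreatCircle

variable {V : Type*} [NormedAddCommGroup V] [InnerProductSpace ℝ V]

theorem eq_of_hasDerivAt_zero {W : Type*} [NormedAddCommGroup W] [NormedSpace ℝ W] {J : Set ℝ}
    (hJ : IsOpen J) (hJ' : J.OrdConnected) {f : ℝ → W} (hf : ∀ s ∈ J, HasDerivAt f 0 s)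
    {s s₀ : ℝ} (hs : s ∈ J) (hs₀ : s₀ ∈ J) : f s = f s₀ :=
  hJ.is_const_of_deriv_eq_zero hJ'.isPreconnected
    (fun t ht => (hf t ht).differentiableAt.differentiableWithinAt)
    (fun t ht => (hf t ht).deriv) hs hs₀

/-- A curve on the unit sphere whose acceleration is normal to the sphere runs along a great
circle. -/
theorem eq_great_circle_of_acceleration_normal {J : Set ℝ} (hJ : IsOpen J) (hJ' : J.OrdConnected)
    {P P' P'' : ℝ → V} (hP : ∀ s ∈ J, HasDerivAt P (P' s) s)
    (hP' : ∀ s ∈ J, HasDerivAt P' (P'' s) s) (hnorm : ∀ s ∈ J, ‖P s‖ = 1)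
    (hacc : ∀ s ∈ J, ∀ a, ⟪P s, a⟫_ℝ = 0 → ⟪P'' s, a⟫_ℝ = 0)
    {s₀ : ℝ} (hs₀ : s₀ ∈ J) {ν : ℝ} (hν : 0 < ν) (hspeed : ‖P' s₀‖ = ν) {s : ℝ} (hs : s ∈ J) :
    P s = Real.cos (ν * (s - s₀)) • P s₀ + (Real.sin (ν * (s - s₀)) / ν) • P' s₀ := by
  have hPP : ∀ s ∈ J, ⟪P s, P s⟫_ℝ = 1 := fun s hs => by
    rw [real_inner_self_eq_norm_sq, hnorm s hs, one_pow]
  have horth : ∀ s ∈ J, ⟪P s, P' s⟫_ℝ = 0 := fun s hs => by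
    have h1 := (hP s hs).inner ℝ (hP s hs)
    have h2 : HasDerivAt (fun t => ⟪P t, P t⟫_ℝ) 0 s :=
      (hasDerivAt_const s (1 : ℝ)).congr_of_eventuallyEq
        (eventually_of_mem (hJ.mem_nhds hs) hPP)
    have h3 := h1.unique h2
    rw [real_inner_comm (P s) (P' s)] at h3
    linarith
  have hPP'' : ∀ s ∈ J, ⟪P s, P'' s⟫_ℝ = -⟪P' s, P' s⟫_ℝ := fun s hs => by
    have h1 := (hP s hs).inner ℝ (hP' s hs)
    have h2 : HasDerivAt (fun t => ⟪P t, P' t⟫_ℝ) 0 s :=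
      (hasDerivAt_const s (0 : ℝ)).congr_of_eventuallyEq
        (eventually_of_mem (hJ.mem_nhds hs) horth)
    have h3 := h1.unique h2
    linarith
  -- The difference of the two sides is orthogonal to `P`, hence by hypothesis also to `P''`. It is
  -- therefore orthogonal to itself.
  have hode : ∀ s ∈ J, P'' s = -(⟪P' s, P' s⟫_ℝ) • P s := fun s hs => by
    have h1 : ⟪P s, P'' s - (-(⟪P' s, P' s⟫_ℝ) • P s)⟫_ℝ = 0 := by
      rw [inner_sub_right, inner_smul_right, hPP s hs, hPP'' s hs]
      ring
    have h2 := hacc s hs _ h1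
    rw [← sub_eq_zero, ← inner_self_eq_zero (𝕜 := ℝ)]
    rw [inner_sub_left, h2, inner_smul_left, h1]
    simp
  have hspeed' : ∀ s ∈ J, ⟪P' s, P' s⟫_ℝ = ν ^ 2 := fun s hs => by
    rw [eq_of_hasDerivAt_zero hJ hJ' (f := fun t => ⟪P' t, P' t⟫_ℝ) (fun t ht => ?_) hs hs₀,
      real_inner_self_eq_norm_sq, hspeed]
    refine ((hP' t ht).inner ℝ (hP' t ht)).congr_deriv ?_
    have h1 := horth t ht
    rw [real_inner_comm] at h1
    rw [hode t ht, inner_smul_right, inner_smul_left, horth t ht, h1]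
    simp
  have hc : ∀ t, HasDerivAt (fun t => Real.cos (ν * (t - s₀))) (-(ν * Real.sin (ν * (t - s₀)))) t :=
    fun t => by
      have := (((hasDerivAt_id t).sub_const s₀).const_mul ν).cos
      simpa [mul_comm] using this
  have hsn : ∀ t, HasDerivAt (fun t => Real.sin (ν * (t - s₀))) (ν * Real.cos (ν * (t - s₀))) t :=
    fun t => by
      have := (((hasDerivAt_id t).sub_const s₀).const_mul ν).sin
      simpa [mul_comm] using this
  -- Undoing the rotation by `ν (t - s₀)` in the solution of `P'' = -ν² P` gives two conserved
  -- vectors, whose values at `s₀` are `P s₀` and `P' s₀`.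
  have hA := eq_of_hasDerivAt_zero hJ hJ'
    (f := fun t => Real.cos (ν * (t - s₀)) • P t - (Real.sin (ν * (t - s₀)) / ν) • P' t)
    (fun t ht => by
      refine (((hc t).smul (hP t ht)).sub (((hsn t).div_const ν).smul (hP' t ht))).congr_deriv ?_
      rw [hode t ht, hspeed' t ht]
      match_scalars <;> field_simp <;> ring) hs hs₀
  have hB := eq_of_hasDerivAt_zero hJ hJ'
    (f := fun t => (ν * Real.sin (ν * (t - s₀))) • P t + Real.cos (ν * (t - s₀)) • P' t)
    (fun t ht => by
      refine ((((hsn t).const_mul ν).smul (hP t ht)).add ((hc t).smul (hP' t ht))).congr_deriv ?_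
      rw [hode t ht, hspeed' t ht]
      match_scalars <;> ring) hs hs₀
  simp only [sub_self, mul_zero, Real.cos_zero, Real.sin_zero, zero_div, zero_smul, one_smul,
    sub_zero, zero_add] at hA hB
  rw [← hA, ← hB]
  match_scalars
  · field_simp
    linear_combination -(Real.sin_sq_add_cos_sq (ν * (s - s₀)))
  · field_simp
    ring

end GreatCircle

/-! ### Spinors and orthonormal pairs in `ℝ³` -/

section Frame

/-- The isotropic vector `(y₀² - y₁², i (y₀² + y₁²), -2 y₀ y₁)` of `ℂ³`. -/
def isotropicVector (y : EuclideanSpace ℂ (Fin 2)) : Fin 3 → ℂ :=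
  ![y 0 ^ 2 - y 1 ^ 2, Complex.I * (y 0 ^ 2 + y 1 ^ 2), -2 * (y 0 * y 1)]

/-- The first vector of the orthogonal frame of `ℝ³` defined by the spinor `y`. -/
def frameFst (y : EuclideanSpace ℂ (Fin 2)) : EuclideanSpace ℝ (Fin 3) :=
  WithLp.toLp 2 fun i => (isotropicVector y i).re

/-- The second vector of the orthogonal frame of `ℝ³` defined by the spinor `y`. -/
def frameSnd (y : EuclideanSpace ℂ (Fin 2)) : EuclideanSpace ℝ (Fin 3) :=
  WithLp.toLp 2 fun i => -(isotropicVector y i).im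

theorem isotropicVector_eq (y : EuclideanSpace ℂ (Fin 2)) (i : Fin 3) :
    isotropicVector y i = frameFst y i - Complex.I * frameSnd y i := by
  apply Complex.ext <;> simp [frameFst, frameSnd]

/-- The entries are quadratic forms in `y`. Hence a unit scalar of angle `θ` turns the frame by
`2θ`, which is the source of the factor `2` in `2c`. -/
theorem isotropicVector_smul (a : ℂ) (y : EuclideanSpace ℂ (Fin 2)) (i : Fin 3) :
    isotropicVector (a • y) i = a ^ 2 * isotropicVector y i := by
  fin_cases i <;> simp [isotropicVector] <;> ring

theorem frameFst_smul (a : ℂ) (y : EuclideanSpace ℂ (Fin 2)) :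
    frameFst (a • y) = (a ^ 2).re • frameFst y + (a ^ 2).im • frameSnd y := by
  ext i
  simp only [frameFst, frameSnd, isotropicVector_smul, Complex.mul_re, PiLp.add_apply,
    PiLp.smul_apply, smul_eq_mul]
  ring

theorem frameSnd_smul (a : ℂ) (y : EuclideanSpace ℂ (Fin 2)) :
    frameSnd (a • y) = (a ^ 2).re • frameSnd y - (a ^ 2).im • frameFst y := by
  ext i
  simp only [frameFst, frameSnd, isotropicVector_smul, Complex.mul_im, PiLp.sub_apply,
    PiLp.smul_apply, smul_eq_mul]
  ring

theorem norm_sq_eq_re_im (y : EuclideanSpace ℂ (Fin 2)) :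
    ‖y‖ ^ 2 = (y 0).re ^ 2 + (y 0).im ^ 2 + ((y 1).re ^ 2 + (y 1).im ^ 2) := by
  rw [EuclideanSpace.norm_sq_eq, Fin.sum_univ_two]
  simp only [Complex.sq_norm, Complex.normSq_apply]
  ring

theorem inner_euclideanSpace_three (a b : EuclideanSpace ℝ (Fin 3)) :
    ⟪a, b⟫_ℝ = a 0 * b 0 + a 1 * b 1 + a 2 * b 2 := by
  rw [PiLp.inner_apply, Fin.sum_univ_three]
  simp [mul_comm]

theorem inner_frameFst_frameFst (y : EuclideanSpace ℂ (Fin 2)) :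
    ⟪frameFst y, frameFst y⟫_ℝ = (‖y‖ ^ 2) ^ 2 := by
  rw [norm_sq_eq_re_im, inner_euclideanSpace_three]
  simp [frameFst, isotropicVector, sq]
  ring

theorem inner_frameSnd_frameSnd (y : EuclideanSpace ℂ (Fin 2)) :
    ⟪frameSnd y, frameSnd y⟫_ℝ = (‖y‖ ^ 2) ^ 2 := by
  rw [norm_sq_eq_re_im, inner_euclideanSpace_three]
  simp [frameSnd, isotropicVector, sq]
  ring

theorem inner_frameFst_frameSnd (y : EuclideanSpace ℂ (Fin 2)) :
    ⟪frameFst y, frameSnd y⟫_ℝ = 0 := by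
  rw [inner_euclideanSpace_three]
  simp [frameFst, frameSnd, isotropicVector, sq]
  ring

theorem norm_frameFst (y : S3) : ‖frameFst y‖ = 1 := by
  have h := inner_frameFst_frameFst y
  rw [real_inner_self_eq_norm_sq, norm_eq_of_mem_sphere] at h
  exact (sq_eq_sq₀ (norm_nonneg _) zero_le_one).1 (by simpa using h)

theorem norm_frameSnd (y : S3) : ‖frameSnd y‖ = 1 := by
  have h := inner_frameSnd_frameSnd y
  rw [real_inner_self_eq_norm_sq, norm_eq_of_mem_sphere] at h
  exact (sq_eq_sq₀ (norm_nonneg _) zero_le_one).1 (by simpa using h)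

/-- The quadratic products `yᵢ yⱼ`, in terms of an isotropic vector. -/
def spinorSquare (n : Fin 3 → ℂ) : Matrix (Fin 2) (Fin 2) ℂ :=
  !![(n 0 - Complex.I * n 1) / 2, -n 2 / 2; -n 2 / 2, (-n 0 - Complex.I * n 1) / 2]

/-- The isotropic vector is an invertible linear function of the three monomials `y₀²`, `y₀ y₁`,
`y₁²`, and `spinorSquare` is its inverse. It recovers from a frame everything about the spinor
except the sign, without choosing a root. -/
theorem spinorSquare_isotropicVector (y : EuclideanSpace ℂ (Fin 2)) (i j : Fin 2) :
    spinorSquare (isotropicVector y) i j = y i * y j := by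
  have hI := Complex.I_mul_I
  fin_cases i <;> fin_cases j <;> simp [spinorSquare, isotropicVector]
  · linear_combination (-(y 0 ^ 2 + y 1 ^ 2) / 2) * hI
  · ring
  · linear_combination (-(y 0 ^ 2 + y 1 ^ 2) / 2) * hI

/-- A spinor is determined by its frame up to sign. -/
theorem eq_or_eq_neg_of_frame_eq {y y' : EuclideanSpace ℂ (Fin 2)}
    (h1 : frameFst y = frameFst y') (h2 : frameSnd y = frameSnd y') : y = y' ∨ y = -y' := by
  have h : isotropicVector y = isotropicVector y' := by
    ext i
    rw [isotropicVector_eq, isotropicVector_eq, h1, h2]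
  have hm : ∀ i j, y i * y j = y' i * y' j := fun i j => by
    rw [← spinorSquare_isotropicVector, ← spinorSquare_isotropicVector, h]
  by_cases h0 : y' = 0
  · left
    ext i
    have := hm i i
    simp [h0] at this
    simp [h0, this]
  · obtain ⟨k, hk⟩ : ∃ k, y' k ≠ 0 := by
      by_contra! hcon
      exact h0 (by ext i; simp [hcon])
    rcases mul_self_eq_mul_self_iff.1 (hm k k) with h3 | h3
    · left
      ext i
      have := hm i k
      rw [h3] at this
      exact mul_right_cancel₀ hk this
    · right
      ext i
      have := hm i k
      rw [h3] at this
      refine mul_right_cancel₀ hk ?_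
      simp
      linear_combination -this

/-- Every orthonormal pair in `ℝ³` comes from a unit spinor. -/
theorem exists_frame_eq {a b : EuclideanSpace ℝ (Fin 3)} (ha : ‖a‖ = 1) (hb : ‖b‖ = 1)
    (hab : ⟪a, b⟫_ℝ = 0) : ∃ y : S3, frameFst y = a ∧ frameSnd y = b := by
  set n : Fin 3 → ℂ := fun i => a i - Complex.I * b i with hn
  have hI := Complex.I_mul_I
  have ha' : (a 0 * a 0 + a 1 * a 1 + a 2 * a 2 : ℝ) = 1 := by
    have : ⟪a, a⟫_ℝ = 1 := by rw [real_inner_self_eq_norm_sq, ha, one_pow]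
    rwa [inner_euclideanSpace_three] at this
  have hb' : (b 0 * b 0 + b 1 * b 1 + b 2 * b 2 : ℝ) = 1 := by
    have : ⟪b, b⟫_ℝ = 1 := by rw [real_inner_self_eq_norm_sq, hb, one_pow]
    rwa [inner_euclideanSpace_three] at this
  have hab' : (a 0 * b 0 + a 1 * b 1 + a 2 * b 2 : ℝ) = 0 := by
    rwa [inner_euclideanSpace_three] at hab
  have hiso : n 0 * n 0 + n 1 * n 1 + n 2 * n 2 = 0 := by
    have h1 := congrArg (fun r : ℝ => (r : ℂ)) ha'
    have h2 := congrArg (fun r : ℝ => (r : ℂ)) hb'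
    have h3 := congrArg (fun r : ℝ => (r : ℂ)) hab'
    push_cast at h1 h2 h3
    simp only [hn]
    linear_combination h1 + Complex.I * Complex.I * h2 - 2 * Complex.I * h3 + hI
  obtain ⟨p, r, hp, hr, hpr⟩ : ∃ p r : ℂ, p * p = (n 0 - Complex.I * n 1) / 2 ∧
      r * r = (-n 0 - Complex.I * n 1) / 2 ∧ p * r = -n 2 / 2 := by
    obtain ⟨p, hp⟩ := IsAlgClosed.exists_eq_mul_self ((n 0 - Complex.I * n 1) / 2)
    obtain ⟨r, hr⟩ := IsAlgClosed.exists_eq_mul_self ((-n 0 - Complex.I * n 1) / 2)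
    -- Isotropy of `n` says that the matrix `spinorSquare n` has determinant zero, so `p r` is right
    -- up to sign. If the sign is wrong, `r` is replaced by `-r`.
    have h1 : (p * r) * (p * r) = (-n 2 / 2) * (-n 2 / 2) := by
      have h2 : (p * r) * (p * r) = (p * p) * (r * r) := by ring
      rw [h2, ← hp, ← hr]
      linear_combination (-1 / 4 : ℂ) * hiso + (n 1 * n 1 / 4) * hI
    rcases mul_self_eq_mul_self_iff.1 h1 with h3 | h3
    · exact ⟨p, r, hp.symm, hr.symm, h3⟩
    · exact ⟨p, -r, hp.symm, by rw [neg_mul_neg, hr], by rw [mul_neg, h3, neg_neg]⟩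
  have hy : isotropicVector !₂[p, r] = n := by
    ext i
    fin_cases i <;> simp [isotropicVector]
    · linear_combination hp - hr
    · linear_combination Complex.I * hp + Complex.I * hr - n 1 * hI
    · linear_combination -2 * hpr
  have h1 : frameFst !₂[p, r] = a := by
    ext i
    simp [frameFst, hy, hn]
  have h2 : frameSnd !₂[p, r] = b := by
    ext i
    simp [frameSnd, hy, hn]
  refine ⟨⟨!₂[p, r], ?_⟩, h1, h2⟩
  have h3 := inner_frameFst_frameFst !₂[p, r]
  rw [h1, real_inner_self_eq_norm_sq, ha] at h3
  rw [mem_sphere_zero_iff_norm]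
  have h4 : ‖!₂[p, r]‖ ^ 2 = 1 := (sq_eq_sq₀ (sq_nonneg _) zero_le_one).1 h3.symm |>.trans (by simp)
  exact (sq_eq_sq₀ (norm_nonneg _) zero_le_one).1 (h4.trans (by simp))

end Frame

/-! ### The explicit null geodesics -/

section NullCurve

theorem contDiff_isotropicVector (i : Fin 3) :
    ContDiff ℝ ∞ (fun y : EuclideanSpace ℂ (Fin 2) => isotropicVector y i) := by
  have h : ∀ j : Fin 2, ContDiff ℝ ∞ (fun y : EuclideanSpace ℂ (Fin 2) => y j) := fun j =>
    (contDiff_piLp_apply (p := 2) (𝕜 := ℝ) (i := j))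
  fin_cases i
  · exact ((h 0).pow 2).sub ((h 1).pow 2)
  · exact contDiff_const.mul (((h 0).pow 2).add ((h 1).pow 2))
  · exact contDiff_const.mul ((h 0).mul (h 1))

theorem contDiff_frameFst : ContDiff ℝ ∞ frameFst := by
  rw [contDiff_piLp]
  exact fun i => Complex.reCLM.contDiff.comp (contDiff_isotropicVector i)

theorem contDiff_frameSnd : ContDiff ℝ ∞ frameSnd := by
  rw [contDiff_piLp]
  exact fun i => (Complex.imCLM.contDiff.comp (contDiff_isotropicVector i)).neg

/-- The map `S³ → S²` given by the first vector of the frame. -/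
def spherePoint (y : S3) : S2 := ⟨frameFst y, by rw [mem_sphere_zero_iff_norm, norm_frameFst]⟩

/-- The curve `s ↦ (cos (k s) a + sin (k s) b, exp (i c k s) z)`, where `a`, `b` is the frame
of `y`. -/
def nullCurve (c : ℕ) (y : S3) (z : Circle) (k s : ℝ) : S2 × Circle :=
  (spherePoint (Circle.exp (k * s / 2) • y), Circle.exp (c * k * s) * z)

theorem coe_exp_half_sq (t : ℝ) : (Circle.exp (t / 2) : ℂ) ^ 2 = Complex.exp (t * Complex.I) := by
  rw [Circle.coe_exp, ← Complex.exp_nat_mul]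
  congr 1
  push_cast
  ring

theorem coe_spherePoint_exp_smul (y : S3) (t : ℝ) :
    (spherePoint (Circle.exp (t / 2) • y) : EuclideanSpace ℝ (Fin 3))
      = Real.cos t • frameFst y + Real.sin t • frameSnd y := by
  change frameFst ((Circle.exp (t / 2) : ℂ) • (y : EuclideanSpace ℂ (Fin 2))) = _
  rw [frameFst_smul, coe_exp_half_sq, Complex.exp_ofReal_mul_I_re, Complex.exp_ofReal_mul_I_im]

theorem spacetimeEmbedding_nullCurve (c : ℕ) (y : S3) (z : Circle) (k s : ℝ) :
    spacetimeEmbedding (nullCurve c y z k s)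
      = (Real.cos (k * s) • frameFst y + Real.sin (k * s) • frameSnd y,
        Complex.exp ((c * k * s : ℝ) * Complex.I) * z) := by
  simp only [spacetimeEmbedding, nullCurve, coe_spherePoint_exp_smul, Circle.coe_mul,
    Circle.coe_exp]

theorem spacetimeEmbedding_injective : Function.Injective spacetimeEmbedding := by
  intro m m' h
  obtain ⟨h1, h2⟩ := Prod.mk.inj h
  exact Prod.ext (Subtype.ext h1) (Circle.ext h2)

/-- Joint smoothness in the spinor and the parameter is what later makes the initial velocity smooth
in the spinor. -/
theorem contMDiff_nullCurve_uncurry (c : ℕ) (z : Circle) (k : ℝ) :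
    ContMDiff ((𝓡 3).prod 𝓘(ℝ, ℝ)) modelS2S1 ∞
      (fun p : S3 × ℝ => nullCurve c p.1 z k p.2) := by
  have := Fact.mk (@finrank_euclideanSpace_fin ℝ _ (2 + 1))
  have hmul : ∀ r : ℝ, ContMDiff ((𝓡 3).prod 𝓘(ℝ, ℝ)) 𝓘(ℝ, ℝ) ∞ (fun p : S3 × ℝ => r * p.2) :=
    fun r => (contDiff_const.mul contDiff_id).contMDiff.comp contMDiff_snd
  have hcoe : ContMDiff ((𝓡 3).prod 𝓘(ℝ, ℝ)) 𝓘(ℝ, EuclideanSpace ℂ (Fin 2)) ∞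
      (fun p : S3 × ℝ => (p.1 : EuclideanSpace ℂ (Fin 2))) :=
    (contMDiff_coe_sphere (n := 3)).comp contMDiff_fst
  refine ContMDiff.prodMk ?_ ?_
  · have h : ContMDiff ((𝓡 3).prod 𝓘(ℝ, ℝ)) 𝓘(ℝ, EuclideanSpace ℝ (Fin 3)) ∞
        (fun p : S3 × ℝ => (spherePoint (Circle.exp (k * p.2 / 2) • p.1) :
          EuclideanSpace ℝ (Fin 3))) := by
      simp only [coe_spherePoint_exp_smul]
      exact ((Real.contDiff_cos.contMDiff.comp (hmul k)).smul
        (contDiff_frameFst.contMDiff.comp hcoe)).add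
        ((Real.contDiff_sin.contMDiff.comp (hmul k)).smul (contDiff_frameSnd.contMDiff.comp hcoe))
    exact h.codRestrict_sphere (n := 2) (fun p => (spherePoint _).2)
  · exact (contMDiff_circleExp.comp (hmul (c * k))).mul contMDiff_const

theorem contMDiff_nullCurve (c : ℕ) (y : S3) (z : Circle) (k : ℝ) :
    ContMDiff 𝓘(ℝ, ℝ) modelS2S1 ∞ (fun s => nullCurve c y z k s) := by
  have h : ContMDiff 𝓘(ℝ, ℝ) ((𝓡 3).prod 𝓘(ℝ, ℝ)) ∞ (fun s : ℝ => ((y, s) : S3 × ℝ)) := by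
    apply ContMDiff.prodMk
    · exact contMDiff_const
    · exact contMDiff_id
  have h' := ContMDiff.comp (contMDiff_nullCurve_uncurry c z k) h
  exact h'

theorem hasDerivAt_spacetimeEmbedding_nullCurve (c : ℕ) (y : S3) (z : Circle) (k s : ℝ) :
    HasDerivAt (spacetimeEmbedding ∘ nullCurve c y z k)
      (k • (Real.cos (k * s) • frameSnd y - Real.sin (k * s) • frameFst y),
        (c * k : ℝ) • (Complex.I * (Complex.exp ((c * k * s : ℝ) * Complex.I) * z))) s := by
  have h : spacetimeEmbedding ∘ nullCurve c y z k = fun s =>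
      (Real.cos (k * s) • frameFst (y : EuclideanSpace ℂ (Fin 2)) + Real.sin (k * s) • frameSnd y,
        Complex.exp ((c * k * s : ℝ) * Complex.I) * z) :=
    funext (spacetimeEmbedding_nullCurve c y z k)
  rw [h]
  have h1 : HasDerivAt (fun s : ℝ => k * s) k s := by
    simpa using (hasDerivAt_id s).const_mul k
  have h2 : HasDerivAt (fun s : ℝ => c * k * s) (c * k) s := by
    simpa using (hasDerivAt_id s).const_mul (c * k)
  refine HasDerivAt.prodMk ?_ ?_
  · refine ((h1.cos.smul_const _).add (h1.sin.smul_const _)).congr_deriv ?_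
    module
  · refine (((h2.ofReal_comp.mul_const Complex.I).cexp).mul_const _).congr_deriv ?_
    rw [Complex.real_smul]
    ring

theorem deriv_deriv_spacetimeEmbedding_nullCurve (c : ℕ) (y : S3) (z : Circle) (k s : ℝ) :
    deriv (deriv (spacetimeEmbedding ∘ nullCurve c y z k)) s
      = (-k ^ 2 • ((nullCurve c y z k s).1 : EuclideanSpace ℝ (Fin 3)),
        (-(c * k) ^ 2 : ℝ) • ((nullCurve c y z k s).2 : ℂ)) := by
  have h : deriv (spacetimeEmbedding ∘ nullCurve c y z k) = fun s =>
      (k • (Real.cos (k * s) • frameSnd (y : EuclideanSpace ℂ (Fin 2))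
          - Real.sin (k * s) • frameFst y),
        (c * k : ℝ) • (Complex.I * (Complex.exp ((c * k * s : ℝ) * Complex.I) * z))) :=
    funext fun s => (hasDerivAt_spacetimeEmbedding_nullCurve c y z k s).deriv
  rw [h]
  have h0 := spacetimeEmbedding_nullCurve c y z k s
  obtain ⟨h01, h02⟩ := Prod.mk.inj h0
  rw [h01, h02]
  have h1 : HasDerivAt (fun s : ℝ => k * s) k s := by
    simpa using (hasDerivAt_id s).const_mul k
  have h2 : HasDerivAt (fun s : ℝ => c * k * s) (c * k) s := by
    simpa using (hasDerivAt_id s).const_mul (c * k)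
  refine (HasDerivAt.prodMk (((h1.cos.smul_const _).sub (h1.sin.smul_const _)).const_smul k)
    ((((h2.ofReal_comp.mul_const Complex.I).cexp.mul_const _).const_mul Complex.I).const_smul
      (c * k : ℝ))).deriv.trans (Prod.ext ?_ ?_)
  · dsimp only
    module
  · simp only [Complex.real_smul]
    push_cast
    linear_combination (c ^ 2 * k ^ 2 * Complex.exp (c * k * s * Complex.I) * z) * Complex.I_mul_I

theorem isGeodesicOn_nullCurve {c : ℕ} (hc : 1 ≤ c) (y : S3) (z : Circle) (k : ℝ) :
    IsGeodesicOn (spacetimeMetric c) (nullCurve c y z k) univ where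
  nonempty := univ_nonempty
  isOpen := isOpen_univ
  ordConnected := ordConnected_univ
  smooth := (contMDiff_nullCurve c y z k).contMDiffOn
  equation s _ := by
    rw [geodesicEquationAt_spacetimeMetric_iff hc (contMDiff_nullCurve c y z k).contMDiffAt,
      deriv_deriv_spacetimeEmbedding_nullCurve]
    exact ⟨fun a ha => by rw [inner_smul_left, ha, mul_zero],
      fun α hα => by rw [inner_smul_left, hα, mul_zero]⟩

theorem isMaximalGeodesic_nullCurve {c : ℕ} (hc : 1 ≤ c) (y : S3) (z : Circle) (k : ℝ) :
    IsMaximalGeodesic (spacetimeMetric c) (nullCurve c y z k) univ :=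
  ⟨isGeodesicOn_nullCurve hc y z k, fun _ _ _ h _ => univ_subset_iff.1 h⟩

theorem coe_circle_smul_S3 (u : Circle) (y : S3) :
    ((u • y : S3) : EuclideanSpace ℂ (Fin 2)) = (u : ℂ) • (y : EuclideanSpace ℂ (Fin 2)) := rfl

/-- Shifting the parameter of a null curve moves its initial data. -/
theorem nullCurve_add (c : ℕ) (y : S3) (z : Circle) (k s t : ℝ) :
    nullCurve c y z k (s + t)
      = nullCurve c (Circle.exp (k * s / 2) • y) (Circle.exp (c * k * s) * z) k t := by
  simp only [nullCurve, smul_smul, ← mul_assoc, ← Circle.exp_add]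
  congr 5 <;> ring

/-- The vector is `frameSnd` of the spinor multiplied by `exp (iks/2)`, which is again a unit
spinor. -/
theorem norm_rotated_frameSnd (y : S3) (k s : ℝ) :
    ‖Real.cos (k * s) • frameSnd (y : EuclideanSpace ℂ (Fin 2)) - Real.sin (k * s) • frameFst y‖
      = 1 := by
  have h := norm_frameSnd (Circle.exp (k * s / 2) • y)
  rwa [coe_circle_smul_S3, frameSnd_smul, coe_exp_half_sq, Complex.exp_ofReal_mul_I_re,
    Complex.exp_ofReal_mul_I_im] at h

theorem velocity_nullCurve_mem {c : ℕ} (hc : 1 ≤ c) (y : S3) (z : Circle) {k : ℝ} (hk : 0 < k)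
    (s : ℝ) :
    velocity modelS2S1 (nullCurve c y z k) s ∈ futureNullCone (spacetimeMetric c) timeField := by
  have hc' : (0 : ℝ) < c := by exact_mod_cast hc
  have hv := mvfderiv_velocity (contMDiff_nullCurve c y z k).contMDiffAt (s := s)
  rw [(hasDerivAt_spacetimeEmbedding_nullCurve c y z k s).deriv] at hv
  rw [mem_futureNullCone_iff hc]
  change ‖(mvfderiv modelS2S1 spacetimeEmbedding (nullCurve c y z k s) _).1‖ * c
    = ⟪Complex.I * (nullCurve c y z k s).2,
      (mvfderiv modelS2S1 spacetimeEmbedding (nullCurve c y z k s) _).2⟫_ℝ ∧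
    0 < ⟪Complex.I * (nullCurve c y z k s).2,
      (mvfderiv modelS2S1 spacetimeEmbedding (nullCurve c y z k s) _).2⟫_ℝ
  rw [hv]
  have h2 : ⟪Complex.I * (nullCurve c y z k s).2, (c * k : ℝ) •
      (Complex.I * (Complex.exp ((c * k * s : ℝ) * Complex.I) * z))⟫_ℝ = c * k := by
    have h3 : (nullCurve c y z k s).2 = (Complex.exp ((c * k * s : ℝ) * Complex.I) * z) :=
      (Prod.mk.inj (spacetimeEmbedding_nullCurve c y z k s)).2
    rw [← h3, inner_smul_right, real_inner_self_eq_norm_sq, norm_mul, Complex.norm_I,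
      Circle.norm_coe]
    ring
  rw [h2, norm_smul, norm_rotated_frameSnd, Real.norm_of_nonneg hk.le]
  exact ⟨by ring, by positivity⟩

theorem isMaximalNullGeodesic_nullCurve {c : ℕ} (hc : 1 ≤ c) (y : S3) (z : Circle) {k : ℝ}
    (hk : 0 < k) : IsMaximalNullGeodesic (spacetimeMetric c) timeField (nullCurve c y z k) univ :=
  ⟨isMaximalGeodesic_nullCurve hc y z k, fun s _ => velocity_nullCurve_mem hc y z hk s⟩

end NullCurve

/-! ### Classification of the null geodesics -/

section Classification

/-- The position and velocity in `ℝ³ × ℂ` of a tangent vector of `S² × S¹`. -/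
def ambientVector (v : TangentBundle modelS2S1 (S2 × Circle)) :
    (EuclideanSpace ℝ (Fin 3) × ℂ) × (EuclideanSpace ℝ (Fin 3) × ℂ) :=
  (spacetimeEmbedding v.1, mvfderiv modelS2S1 spacetimeEmbedding v.1 v.2)

/-- Equalities of points of the tangent bundle can thus be checked on position and velocity in a
fixed vector space. -/
theorem ambientVector_injective : Function.Injective ambientVector := by
  rintro ⟨m, w⟩ ⟨m', w'⟩ h
  obtain ⟨h1, h2⟩ := Prod.mk.inj h
  obtain rfl := spacetimeEmbedding_injective h1
  obtain rfl := injective_mvfderiv_spacetimeEmbedding m h2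
  rfl

theorem ambientVector_velocity {γ : ℝ → S2 × Circle} {s : ℝ}
    (hγ : ContMDiffAt 𝓘(ℝ, ℝ) modelS2S1 ∞ γ s) :
    ambientVector (velocity modelS2S1 γ s)
      = (spacetimeEmbedding (γ s), deriv (spacetimeEmbedding ∘ γ) s) :=
  Prod.ext rfl (mvfderiv_velocity hγ)

/-- The initial velocity of a null curve. -/
def nullVector (c : ℕ) (y : S3) (z : Circle) (k : ℝ) : TangentBundle modelS2S1 (S2 × Circle) :=
  velocity modelS2S1 (nullCurve c y z k) 0

theorem ambientVector_nullVector (c : ℕ) (y : S3) (z : Circle) (k : ℝ) :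
    ambientVector (nullVector c y z k)
      = ((frameFst y, (z : ℂ)), (k • frameSnd y, (c * k : ℝ) • (Complex.I * (z : ℂ)))) := by
  rw [nullVector, ambientVector_velocity (contMDiff_nullCurve c y z k).contMDiffAt,
    spacetimeEmbedding_nullCurve, (hasDerivAt_spacetimeEmbedding_nullCurve c y z k 0).deriv]
  simp

theorem eq_inner_smul_of_orthogonal {z α : ℂ} (hz : ‖z‖ = 1) (hα : ⟪z, α⟫_ℝ = 0) :
    α = ⟪Complex.I * z, α⟫_ℝ • (Complex.I * z) := by
  have hz' : z.re * z.re + z.im * z.im = 1 := by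
    rw [← Complex.normSq_apply, Complex.normSq_eq_norm_sq, hz, one_pow]
  simp only [Complex.inner, Complex.mul_re, Complex.mul_im, Complex.conj_re, Complex.conj_im,
    Complex.I_re, Complex.I_im] at *
  apply Complex.ext
  · simp
    linear_combination (-α.re) * hz' + z.re * hα
  · simp
    linear_combination (-α.im) * hz' + z.im * hα

/-- Every future-pointing null vector is the initial velocity of a null curve. -/
theorem exists_eq_nullVector {c : ℕ} (hc : 1 ≤ c) {v : TangentBundle modelS2S1 (S2 × Circle)}
    (hv : v ∈ futureNullCone (spacetimeMetric c) timeField) :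
    ∃ (y : S3) (z : Circle) (k : ℝ), 0 < k ∧ v = nullVector c y z k := by
  have hc' : (0 : ℝ) < c := by exact_mod_cast hc
  obtain ⟨h1, h2⟩ := (mem_futureNullCone_iff hc v).1 hv
  have h3 := mvfderiv_spacetimeEmbedding_fst_orthogonal v.1 v.2
  have h4 := eq_inner_smul_of_orthogonal (Circle.norm_coe v.1.2)
    (mvfderiv_spacetimeEmbedding_snd_orthogonal v.1 v.2)
  have hamb : ambientVector v = (((v.1.1 : EuclideanSpace ℝ (Fin 3)), (v.1.2 : ℂ)),
    ((mvfderiv modelS2S1 spacetimeEmbedding v.1 v.2).1,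
      (mvfderiv modelS2S1 spacetimeEmbedding v.1 v.2).2)) := rfl
  generalize (mvfderiv modelS2S1 spacetimeEmbedding v.1 v.2).1 = a at *
  generalize (mvfderiv modelS2S1 spacetimeEmbedding v.1 v.2).2 = α at *
  have hk : 0 < ‖a‖ := by
    rw [← h1] at h2
    exact pos_of_mul_pos_left h2 hc'.le
  obtain ⟨y, hy1, hy2⟩ := exists_frame_eq (a := v.1.1) (b := ‖a‖⁻¹ • a)
    (norm_eq_of_mem_sphere _) (by rw [norm_smul, norm_inv, norm_norm, inv_mul_cancel₀ hk.ne'])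
    (by rw [inner_smul_right, h3, mul_zero])
  refine ⟨y, v.1.2, ‖a‖, hk, ambientVector_injective ?_⟩
  rw [ambientVector_nullVector, hamb, hy1, hy2, smul_inv_smul₀ hk.ne']
  congr 2
  rw [h4, ← h1, mul_comm]

theorem velocity_nullCurve (c : ℕ) (y : S3) (z : Circle) (k s : ℝ) :
    velocity modelS2S1 (nullCurve c y z k) s
      = nullVector c (Circle.exp (k * s / 2) • y) (Circle.exp (c * k * s) * z) k := by
  apply ambientVector_injective
  rw [ambientVector_velocity (contMDiff_nullCurve c y z k).contMDiffAt, ambientVector_nullVector,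
    spacetimeEmbedding_nullCurve, (hasDerivAt_spacetimeEmbedding_nullCurve c y z k s).deriv,
    coe_circle_smul_S3, frameFst_smul, frameSnd_smul, coe_exp_half_sq, Complex.exp_ofReal_mul_I_re,
    Complex.exp_ofReal_mul_I_im]
  simp

/-- The classification of the null geodesics of `g_c`. -/
theorem eq_nullCurve_of_isMaximalNullGeodesic {c : ℕ} (hc : 1 ≤ c) {γ : ℝ → S2 × Circle}
    {J : Set ℝ} (h : IsMaximalNullGeodesic (spacetimeMetric c) timeField γ J) :
    J = univ ∧ ∃ (y : S3) (z : Circle) (k : ℝ), 0 < k ∧ γ = nullCurve c y z k := by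
  obtain ⟨⟨⟨⟨s₀, hs₀⟩, hJ, hJ', hsm, heq⟩, hmax⟩, hnull⟩ := h
  have hc' : (0 : ℝ) < c := by exact_mod_cast hc
  have hγ : ∀ s ∈ J, ContMDiffAt 𝓘(ℝ, ℝ) modelS2S1 ∞ γ s := fun s hs =>
    hsm.contMDiffAt (hJ.mem_nhds hs)
  have hX : ∀ s ∈ J, ContDiffAt ℝ ∞ (spacetimeEmbedding ∘ γ) s := fun s hs => by
    rw [← contMDiffAt_iff_contDiffAt]
    exact contMDiff_spacetimeEmbedding.contMDiffAt.comp s (hγ s hs)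
  have hX1 : ∀ s ∈ J, HasDerivAt (spacetimeEmbedding ∘ γ) (deriv (spacetimeEmbedding ∘ γ) s) s :=
    fun s hs => ((hX s hs).differentiableAt (by simp)).hasDerivAt
  have hX2 : ∀ s ∈ J, HasDerivAt (deriv (spacetimeEmbedding ∘ γ))
      (deriv (deriv (spacetimeEmbedding ∘ γ)) s) s := fun s hs => by
    have h1 : ContDiffAt ℝ 1 (deriv (spacetimeEmbedding ∘ γ)) s :=
      ((hX s hs).fderiv_right (m := 1) (WithTop.coe_le_coe.2 le_top)).clm_apply
        (contDiffAt_const (c := (1 : ℝ)))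
    exact (h1.differentiableAt (by simp)).hasDerivAt
  have hgeo := fun s hs => (geodesicEquationAt_spacetimeMetric_iff hc (hγ s hs)).1 (heq s hs)
  obtain ⟨y, z, k, hk, hv⟩ := exists_eq_nullVector hc (hnull s₀ hs₀)
  have hv' := congrArg ambientVector hv
  rw [ambientVector_velocity (hγ s₀ hs₀), ambientVector_nullVector] at hv'
  obtain ⟨hv1, hv2⟩ := Prod.mk.inj hv'
  obtain ⟨hv11, hv12⟩ := Prod.mk.inj hv1
  have hfst : ∀ s ∈ J, ((γ s).1 : EuclideanSpace ℝ (Fin 3)) =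
      Real.cos (k * (s - s₀)) • frameFst y + Real.sin (k * (s - s₀)) • frameSnd y := by
    intro s hs
    have h1 := eq_great_circle_of_acceleration_normal hJ hJ'
      (P := fun s => (spacetimeEmbedding (γ s)).1)
      (P' := fun s => (deriv (spacetimeEmbedding ∘ γ) s).1)
      (P'' := fun s => (deriv (deriv (spacetimeEmbedding ∘ γ)) s).1)
      (fun s hs => (ContinuousLinearMap.fst ℝ (EuclideanSpace ℝ (Fin 3))
        ℂ).hasFDerivAt.comp_hasDerivAt s (hX1 s hs))
      (fun s hs => (ContinuousLinearMap.fst ℝ (EuclideanSpace ℝ (Fin 3))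
        ℂ).hasFDerivAt.comp_hasDerivAt s (hX2 s hs))
      (fun s hs => norm_eq_of_mem_sphere (γ s).1) (fun s hs => (hgeo s hs).1) hs₀ hk
      (by simp only [hv2, norm_smul, norm_frameSnd, Real.norm_of_nonneg hk.le, mul_one]) hs
    simp only [hv2, hv1, smul_smul, div_mul_cancel₀ _ hk.ne'] at h1
    exact h1
  have hck : 0 < c * k := by positivity
  have hsnd : ∀ s ∈ J, ((γ s).2 : ℂ) = Complex.exp ((c * k * (s - s₀) : ℝ) * Complex.I) * z := by
    intro s hs
    -- The circle factor is treated as the unit sphere of `ℂ`, with speed `c k`; the great circle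
    -- formula is then Euler's formula for the exponential.
    have h1 := eq_great_circle_of_acceleration_normal hJ hJ'
      (P := fun s => (spacetimeEmbedding (γ s)).2)
      (P' := fun s => (deriv (spacetimeEmbedding ∘ γ) s).2)
      (P'' := fun s => (deriv (deriv (spacetimeEmbedding ∘ γ)) s).2)
      (fun s hs => (ContinuousLinearMap.snd ℝ (EuclideanSpace ℝ (Fin 3))
        ℂ).hasFDerivAt.comp_hasDerivAt s (hX1 s hs))
      (fun s hs => (ContinuousLinearMap.snd ℝ (EuclideanSpace ℝ (Fin 3))
        ℂ).hasFDerivAt.comp_hasDerivAt s (hX2 s hs))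
      (fun s hs => Circle.norm_coe (γ s).2) (fun s hs => (hgeo s hs).2) hs₀ hck
      (by simp only [hv2, norm_smul, norm_mul, Complex.norm_I, Circle.norm_coe,
            Real.norm_of_nonneg hck.le, mul_one]) hs
    simp only [hv2, hv1, smul_smul, div_mul_cancel₀ _ hck.ne'] at h1
    refine h1.trans ?_
    rw [Complex.exp_mul_I, ← Complex.ofReal_cos, ← Complex.ofReal_sin, Complex.real_smul,
      Complex.real_smul]
    ring
  have hEq : EqOn γ (nullCurve c (Circle.exp (k * (-s₀) / 2) • y)
      (Circle.exp (c * k * (-s₀)) * z) k) J := by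
    intro s hs
    rw [← nullCurve_add, neg_add_eq_sub]
    apply spacetimeEmbedding_injective
    rw [spacetimeEmbedding_nullCurve, ← hfst s hs, ← hsnd s hs]
    rfl
  -- The explicit curve is a geodesic on all of `ℝ` that extends `γ`, so maximality forces `J` to be
  -- the whole line.
  have hJu := hmax _ univ (isGeodesicOn_nullCurve hc _ _ k) (subset_univ J) hEq
  have hall : γ = nullCurve c (Circle.exp (k * (-s₀) / 2) • y)
      (Circle.exp (c * k * (-s₀)) * z) k := funext fun s => hEq (hJu.subset (mem_univ s))
  exact ⟨hJu.symm, _, _, k, hk, hall⟩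

end Classification

/-! ### The covering `S³ → L(p, 1)` -/

section Lens

variable {p : ℕ}

/-- The covering `S³ → L(p, 1)`. -/
def lensMk (p : ℕ) (y : S3) : LensSpace p := Quotient.mk _ y

theorem lensMk_surjective (p : ℕ) : Function.Surjective (lensMk p) := Quotient.mk_surjective

theorem lensMk_smul (a : cyclicGroup p) (y : S3) : lensMk p (a • y) = lensMk p y :=
  Quotient.sound ⟨a, rfl⟩

theorem isLocalHomeomorph_lensMk (p : ℕ) : IsLocalHomeomorph (lensMk p) :=
  isQuotientCoveringMap_quotientMk_of_properlyDiscontinuousSMul.isCoveringMap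
    |>.isLocalHomeomorph

theorem exists_chartAt_lensSpace (q : LensSpace p) : ∃ x : S3, lensMk p x = q ∧
    chartAt (EuclideanSpace ℝ (Fin 3)) q
      = ((isLocalHomeomorph_lensMk p).localInverseAt x).trans
        (chartAt (EuclideanSpace ℝ (Fin 3)) x) :=
  ⟨(lensMk_surjective p).hasRightInverse.choose q,
    (lensMk_surjective p).hasRightInverse.choose_spec q, rfl⟩

theorem secondCountableTopology_lensSpace (p : ℕ) : SecondCountableTopology (LensSpace p) :=
  ContinuousConstSMul.secondCountableTopology

/-- The chart at the image of `y` is built from a chosen preimage, which is some `a • y`. Near `a •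
y` the covering is the identity in charts; smoothness at `y` follows by invariance under `a`. -/
theorem contMDiff_lensMk (p : ℕ) : ContMDiff (𝓡 3) (𝓡 3) ∞ (lensMk p) := by
  intro y
  obtain ⟨x, hx, hchart⟩ := exists_chartAt_lensSpace (lensMk p y)
  obtain ⟨a, rfl⟩ : ∃ a : cyclicGroup p, a • y = x := Quotient.exact hx
  set e := (isLocalHomeomorph_lensMk p).localInverseAt (a • y) with he
  have hmem : a • y ∈ e.target := (isLocalHomeomorph_lensMk p).self_mem_localInverseAt_target
  have hloc : ContMDiffAt (𝓡 3) (𝓡 3) ∞ (lensMk p) (a • y) := by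
    have h1 : ContMDiffAt (𝓡 3) (𝓡 3) ∞ (chartAt (EuclideanSpace ℝ (Fin 3)) (lensMk p y)).symm
        (chartAt (EuclideanSpace ℝ (Fin 3)) (a • y) (a • y)) := by
      refine (contMDiffOn_chart_symm (I := 𝓡 3) (n := ∞)).contMDiffAt
        ((chartAt (EuclideanSpace ℝ (Fin 3)) (lensMk p y)).open_target.mem_nhds ?_)
      rw [hchart]
      simp [he]
    have h2 : ContMDiffAt (𝓡 3) (𝓡 3) ∞ (chartAt (EuclideanSpace ℝ (Fin 3)) (a • y)) (a • y) :=
      contMDiffAt_of_mem_maximalAtlas (IsManifold.chart_mem_maximalAtlas _) (mem_chart_source _ _)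
    refine (h1.comp _ h2).congr_of_eventuallyEq ?_
    filter_upwards [(chartAt (EuclideanSpace ℝ (Fin 3)) (a • y)).open_source.mem_nhds
      (mem_chart_source _ _)] with w hw
    rw [hchart]
    simp [hw, he]
  have h3 := hloc.comp y (contMDiff_smul_S3 (a : Circle)).contMDiffAt
  exact h3.congr_of_eventuallyEq (Eventually.of_forall fun w => (lensMk_smul a w).symm)

/-- The covering `S³ → L(p, 1)` has smooth local sections. -/
theorem exists_section_lensMk (p : ℕ) (y : S3) : ∃ (U : Set (LensSpace p)) (ℓ : LensSpace p → S3),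
    IsOpen U ∧ lensMk p y ∈ U ∧ ContMDiffOn (𝓡 3) (𝓡 3) ∞ ℓ U ∧ ℓ (lensMk p y) = y ∧
      ∀ n ∈ U, lensMk p (ℓ n) = n := by
  obtain ⟨x, hx, hchart⟩ := exists_chartAt_lensSpace (lensMk p y)
  obtain ⟨a, rfl⟩ : ∃ a : cyclicGroup p, a • y = x := Quotient.exact hx
  set e := (isLocalHomeomorph_lensMk p).localInverseAt (a • y) with he
  set C := chartAt (EuclideanSpace ℝ (Fin 3)) (lensMk p y) with hC
  have hsrc : ∀ n ∈ C.source, n ∈ e.source ∧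
      e n ∈ (chartAt (EuclideanSpace ℝ (Fin 3)) (a • y)).source := fun n hn => by
    rw [hchart] at hn
    simpa using hn
  have hℓ : ContMDiffOn (𝓡 3) (𝓡 3) ∞ e C.source := by
    have h1 : ContMDiffOn (𝓡 3) (𝓡 3) ∞ ((chartAt (EuclideanSpace ℝ (Fin 3)) (a • y)).symm ∘ C)
        C.source := by
      refine (contMDiffOn_chart_symm (I := 𝓡 3) (n := ∞)).comp contMDiffOn_chart fun n hn => ?_
      rw [hchart]
      exact (chartAt (EuclideanSpace ℝ (Fin 3)) (a • y)).map_source (hsrc n hn).2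
    refine h1.congr fun n hn => ?_
    rw [hchart]
    exact ((chartAt (EuclideanSpace ℝ (Fin 3)) (a • y)).left_inv (hsrc n hn).2).symm
  -- The local inverse `e` passes through the chosen preimage `a • y`; translating by `a⁻¹` makes
  -- the section pass through `y`.
  refine ⟨C.source, fun n => a⁻¹ • e n, C.open_source, mem_chart_source _ _,
    (contMDiff_smul_S3 ((a⁻¹ : cyclicGroup p) : Circle)).comp_contMDiffOn hℓ, ?_, fun n hn => ?_⟩
  · have h2 : e (lensMk p (a • y)) = a • y :=
      (isLocalHomeomorph_lensMk p).localInverseAt_apply_self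
    rw [lensMk_smul] at h2
    simp only [h2, inv_smul_smul]
  · rw [lensMk_smul]
    exact (isLocalHomeomorph_lensMk p).apply_localInverseAt_of_mem (hsrc n hn).1

/-- A map on `L(p, 1)` is smooth if it is smooth on `S³`. -/
theorem contMDiff_of_comp_lensMk {E H N : Type*} [NormedAddCommGroup E] [NormedSpace ℝ E]
    [TopologicalSpace H] {I : ModelWithCorners ℝ E H} [TopologicalSpace N] [ChartedSpace H N]
    {f : LensSpace p → N} (hf : ContMDiff (𝓡 3) I ∞ (f ∘ lensMk p)) : ContMDiff (𝓡 3) I ∞ f := by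
  intro q
  obtain ⟨y, rfl⟩ := lensMk_surjective p q
  obtain ⟨U, ℓ, hU, hyU, hℓ, -, hsec⟩ := exists_section_lensMk p y
  have h1 : ContMDiffAt (𝓡 3) I ∞ ((f ∘ lensMk p) ∘ ℓ) (lensMk p y) :=
    hf.contMDiffAt.comp _ (hℓ.contMDiffAt (hU.mem_nhds hyU))
  refine h1.congr_of_eventuallyEq ?_
  filter_upwards [hU.mem_nhds hyU] with n hn
  simp [hsec n hn]

theorem mem_cyclicGroup_iff (hp : p ≠ 0) {u : Circle} : u ∈ cyclicGroup p ↔ u ^ p = 1 := by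
  have hp' : (p : ℝ) ≠ 0 := by exact_mod_cast hp
  constructor
  · rintro ⟨m, rfl⟩
    change (Circle.exp (2 * Real.pi / p) ^ m) ^ p = 1
    rw [← zpow_natCast, ← zpow_mul, mul_comm m, zpow_mul, zpow_natCast, ← Circle.exp_natCast_mul,
      mul_div_cancel₀ _ hp', Circle.exp_two_pi, one_zpow]
  · intro h
    obtain ⟨t, rfl⟩ := Circle.exp_surjective u
    rw [← Circle.exp_natCast_mul, Circle.exp_eq_one] at h
    obtain ⟨m, hm⟩ := h
    refine ⟨m, ?_⟩
    change Circle.exp (2 * Real.pi / p) ^ m = _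
    rw [← Circle.exp_intCast_mul]
    congr 1
    field_simp
    linear_combination -hm

end Lens

/-! ### The bijection between `L(2c, 1)` and the null geodesics -/

section Bijection

variable {c : ℕ}

theorem coe_spherePoint_smul (u : Circle) (y : S3) :
    (spherePoint (u • y) : EuclideanSpace ℝ (Fin 3))
      = ((u : ℂ) ^ 2).re • frameFst y + ((u : ℂ) ^ 2).im • frameSnd y :=
  frameFst_smul _ _

/-- The point with parameter `u` on the null geodesic through `(spherePoint y, z)`. -/
def geodesicPoint (c : ℕ) (y : S3) (z u : Circle) : S2 × Circle :=
  (spherePoint (u • y), u ^ (2 * c) * z)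

theorem nullCurve_eq_geodesicPoint (c : ℕ) (y : S3) (z : Circle) (k s : ℝ) :
    nullCurve c y z k s = geodesicPoint c y z (Circle.exp (k * s / 2)) := by
  rw [nullCurve, geodesicPoint, ← Circle.exp_natCast_mul]
  congr 3
  push_cast
  ring

theorem range_nullCurve (c : ℕ) (y : S3) (z : Circle) {k : ℝ} (hk : 0 < k) :
    range (nullCurve c y z k) = range (geodesicPoint c y z) := by
  have hsurj : Function.Surjective fun s : ℝ => Circle.exp (k * s / 2) := fun u => by
    obtain ⟨t, rfl⟩ := Circle.exp_surjective u
    exact ⟨2 * t / k, by dsimp only; congr 1; field_simp⟩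
  rw [← hsurj.range_comp]
  exact congrArg range (funext fun s => nullCurve_eq_geodesicPoint c y z k s)

/-- The null geodesic with initial data `y`, `z`. -/
def nullGeodesic (hc : 1 ≤ c) (y : S3) (z : Circle) : NullGeodesics c where
  carrier := range (geodesicPoint c y z)
  exists_geodesic := ⟨nullCurve c y z 1, univ, isMaximalNullGeodesic_nullCurve hc y z one_pos,
    by rw [image_univ, range_nullCurve c y z one_pos]⟩

theorem nullGeodesic_smul (hc : 1 ≤ c) (u : Circle) (y : S3) (z : Circle) :
    nullGeodesic hc (u • y) (u ^ (2 * c) * z) = nullGeodesic hc y z := by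
  apply NullGeodesicSpace.ext
  change range (geodesicPoint c (u • y) (u ^ (2 * c) * z)) = range (geodesicPoint c y z)
  rw [← (Equiv.mulRight u).surjective.range_comp (geodesicPoint c y z)]
  congr 1
  funext w
  simp [geodesicPoint, mul_smul, mul_pow, mul_assoc]

theorem nullGeodesic_congr (hc : 1 ≤ c) {y y' : S3} (z : Circle)
    (h1 : frameFst (y : EuclideanSpace ℂ (Fin 2)) = frameFst y')
    (h2 : frameSnd (y : EuclideanSpace ℂ (Fin 2)) = frameSnd y') :
    nullGeodesic hc y z = nullGeodesic hc y' z := by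
  apply NullGeodesicSpace.ext
  change range (geodesicPoint c y z) = range (geodesicPoint c y' z)
  congr 1
  funext w
  refine Prod.ext (Subtype.ext ?_) rfl
  change (spherePoint (w • y) : EuclideanSpace ℝ (Fin 3)) = spherePoint (w • y')
  rw [coe_spherePoint_smul, coe_spherePoint_smul, h1, h2]

/-- The null geodesics to which a given vector is tangent. -/
theorem isTangentTo_iff (hc : 1 ≤ c) {v : TangentBundle modelS2S1 (S2 × Circle)}
    {n : NullGeodesics c} : IsTangentTo v n ↔ ∃ (y : S3) (z : Circle) (k : ℝ),
      0 < k ∧ v = nullVector c y z k ∧ n = nullGeodesic hc y z := by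
  constructor
  · rintro ⟨γ, J, hγ, hn, s, -, rfl⟩
    obtain ⟨rfl, y, z, k, hk, rfl⟩ := eq_nullCurve_of_isMaximalNullGeodesic hc hγ
    refine ⟨_, _, k, hk, velocity_nullCurve c y z k s, ?_⟩
    have h1 : Circle.exp (c * k * s) = Circle.exp (k * s / 2) ^ (2 * c) := by
      rw [← Circle.exp_natCast_mul]
      congr 1
      push_cast
      ring
    rw [h1, nullGeodesic_smul]
    apply NullGeodesicSpace.ext
    rw [← hn, image_univ, range_nullCurve c y z hk]
    rfl
  · rintro ⟨y, z, k, hk, rfl, rfl⟩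
    exact ⟨nullCurve c y z k, univ, isMaximalNullGeodesic_nullCurve hc y z hk,
      by rw [image_univ, range_nullCurve c y z hk]; rfl, 0, mem_univ _, rfl⟩

theorem frame_eq_of_nullVector_eq {y y' : S3} {z z' : Circle} {k k' : ℝ} (hk : 0 < k)
    (hk' : 0 < k') (h : nullVector c y z k = nullVector c y' z' k') :
    frameFst (y : EuclideanSpace ℂ (Fin 2)) = frameFst y' ∧
      frameSnd (y : EuclideanSpace ℂ (Fin 2)) = frameSnd y' ∧ z = z' ∧ k = k' := by
  have h' := congrArg ambientVector h
  rw [ambientVector_nullVector, ambientVector_nullVector] at h'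
  simp only [Prod.mk.injEq] at h'
  obtain ⟨⟨h1, h2⟩, h3, -⟩ := h'
  have hkk : k = k' := by
    have h4 := congrArg norm h3
    rwa [norm_smul, norm_smul, norm_frameSnd, norm_frameSnd, Real.norm_of_nonneg hk.le,
      Real.norm_of_nonneg hk'.le, mul_one, mul_one] at h4
  subst hkk
  exact ⟨h1, smul_right_injective _ hk.ne' h3, Circle.ext h2, rfl⟩

/-- A null vector determines the frame, and the geodesic depends on the spinor only through its
frame. -/
theorem isTangentTo_unique (hc : 1 ≤ c) {v : TangentBundle modelS2S1 (S2 × Circle)}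
    {n n' : NullGeodesics c} (h : IsTangentTo v n) (h' : IsTangentTo v n') : n = n' := by
  obtain ⟨y, z, k, hk, rfl, rfl⟩ := (isTangentTo_iff hc).1 h
  obtain ⟨y', z', k', hk', hv, rfl⟩ := (isTangentTo_iff hc).1 h'
  obtain ⟨h1, h2, rfl, -⟩ := frame_eq_of_nullVector_eq hk hk' hv
  exact nullGeodesic_congr hc z h1 h2

theorem nullVector_mem (hc : 1 ≤ c) (y : S3) (z : Circle) {k : ℝ} (hk : 0 < k) :
    nullVector c y z k ∈ futureNullCone (spacetimeMetric c) timeField :=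
  velocity_nullCurve_mem hc y z hk 0

theorem isTangentTo_nullVector (hc : 1 ≤ c) (y : S3) (z : Circle) {k : ℝ} (hk : 0 < k) :
    IsTangentTo (nullVector c y z k) (nullGeodesic hc y z) :=
  (isTangentTo_iff hc).2 ⟨y, z, k, hk, rfl, rfl⟩

theorem exists_pow_eq_circle {p : ℕ} (hp : p ≠ 0) (z : Circle) : ∃ u : Circle, u ^ p = z := by
  obtain ⟨t, rfl⟩ := Circle.exp_surjective z
  refine ⟨Circle.exp (t / p), ?_⟩
  rw [← Circle.exp_natCast_mul, mul_div_cancel₀ _ (by exact_mod_cast hp)]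

/-- Equality of images alone must give equality of directions at a common starting point. A suitable
point of the first geodesic is located on the second: its `S²` component fixes the turning angle
there up to sign, and its `S¹` component decides the sign. -/
theorem frameSnd_eq_of_nullGeodesic_eq (hc : 1 ≤ c) {y y' : S3}
    (h : nullGeodesic hc y 1 = nullGeodesic hc y' 1)
    (h1 : frameFst (y : EuclideanSpace ℂ (Fin 2)) = frameFst y') :
    frameSnd (y : EuclideanSpace ℂ (Fin 2)) = frameSnd y' := by
  have hc' : (0 : ℝ) < c := by exact_mod_cast hc
  have hset : range (geodesicPoint c y 1) = range (geodesicPoint c y' 1) :=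
    congrArg NullGeodesicSpace.carrier h
  -- With `b = exp (it)`, this choice makes `b ^ c = i`, which differs from its conjugate, while `0
  -- < t < π` keeps `sin t` nonzero.
  set t : ℝ := Real.pi / (2 * c) with ht
  obtain ⟨u, hu⟩ : geodesicPoint c y 1 (Circle.exp (t / 2)) ∈ range (geodesicPoint c y' 1) :=
    hset ▸ mem_range_self _
  obtain ⟨hu1, hu2⟩ := Prod.mk.inj hu
  have hu1 := congrArg Subtype.val hu1
  rw [coe_spherePoint_smul, coe_spherePoint_smul, h1, coe_exp_half_sq] at hu1
  rw [mul_one, mul_one] at hu2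
  have hu2 := congrArg (fun w : Circle => (w : ℂ)) hu2
  simp only [Circle.coe_pow, pow_mul, coe_exp_half_sq] at hu2
  have hI : Complex.exp (t * Complex.I) ^ c = Complex.I := by
    have h3 : (c : ℂ) * (t * Complex.I) = Real.pi / 2 * Complex.I := by
      have hc'' : (c : ℂ) ≠ 0 := by exact_mod_cast hc'.ne'
      rw [ht]
      push_cast
      field_simp
    rw [← Complex.exp_nat_mul, h3, Complex.exp_pi_div_two_mul_I]
  rw [hI] at hu2
  set a := (u : ℂ) ^ 2 with ha
  set b := Complex.exp (t * Complex.I) with hb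
  have hre : a.re = b.re := by
    -- Both second frame vectors are orthogonal to the common first one, so this inner product
    -- isolates the real parts.
    have h3 := congrArg (fun w => ⟪frameFst (y' : EuclideanSpace ℂ (Fin 2)), w⟫_ℝ) hu1
    rw [← h1] at h3
    simp only [inner_add_right, inner_smul_right, h1, inner_frameFst_frameSnd,
      inner_frameFst_frameFst, norm_eq_of_mem_sphere] at h3
    have h4 : ⟪frameFst (y' : EuclideanSpace ℂ (Fin 2)), frameSnd (y : EuclideanSpace ℂ (Fin 2))⟫_ℝ
        = 0 := by rw [← h1, inner_frameFst_frameSnd]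
    rw [h4] at h3
    simpa using h3
  have hna : a.re ^ 2 + a.im ^ 2 = 1 := by
    have h3 : Complex.normSq a = 1 := by simp [ha, map_pow]
    rw [Complex.normSq_apply] at h3
    linarith
  have hnb : b.re ^ 2 + b.im ^ 2 = 1 := by
    rw [hb, Complex.exp_ofReal_mul_I_re, Complex.exp_ofReal_mul_I_im, Real.cos_sq_add_sin_sq]
  have hbim : b.im ≠ 0 := by
    rw [hb, Complex.exp_ofReal_mul_I_im]
    refine (Real.sin_pos_of_pos_of_lt_pi (by positivity) ?_).ne'
    rw [ht, div_lt_iff₀ (by positivity)]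
    have h3 : (1 : ℝ) ≤ c := by exact_mod_cast hc
    nlinarith [Real.pi_pos]
  have him : a.im = b.im := by
    rcases sq_eq_sq_iff_eq_or_eq_neg.1 (by rw [hre] at hna; linarith : a.im ^ 2 = b.im ^ 2)
      with h3 | h3
    · exact h3
    · exfalso
      have h4 : a = (starRingEnd ℂ) b := Complex.ext (by simpa using hre) (by simpa using h3)
      rw [h4, ← map_pow, hI, Complex.conj_I] at hu2
      have := congrArg Complex.im hu2
      norm_num at this
  rw [hre, him] at hu1
  exact (smul_right_injective _ hbim (add_left_cancel hu1)).symm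

theorem exists_smul_eq_of_nullGeodesic_eq (hc : 1 ≤ c) {y y' : S3}
    (h : nullGeodesic hc y 1 = nullGeodesic hc y' 1) : ∃ a : cyclicGroup (2 * c), a • y = y' := by
  have hp : 2 * c ≠ 0 := by omega
  have hset : range (geodesicPoint c y 1) = range (geodesicPoint c y' 1) :=
    congrArg NullGeodesicSpace.carrier h
  -- The starting point of the second geodesic is reached on the first at the parameter `u`. The
  -- circle component gives `u ^ (2c) = 1`, so replacing `y` by `u • y` makes the starting points
  -- agree.
  obtain ⟨u, hu⟩ : geodesicPoint c y' 1 1 ∈ range (geodesicPoint c y 1) :=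
    hset ▸ mem_range_self _
  obtain ⟨hu1, hu2⟩ := Prod.mk.inj hu
  rw [one_pow, mul_one, mul_one] at hu2
  rw [one_smul] at hu1
  have h1 : frameFst ((u • y : S3) : EuclideanSpace ℂ (Fin 2)) = frameFst y' :=
    congrArg Subtype.val hu1
  have h2 : nullGeodesic hc (u • y) 1 = nullGeodesic hc y' 1 := by
    rw [← h, ← nullGeodesic_smul hc u y 1, hu2, mul_one]
  have h3 := frameSnd_eq_of_nullGeodesic_eq hc h2 h1
  rcases eq_or_eq_neg_of_frame_eq h1 h3 with h4 | h4
  · exact ⟨⟨u, (mem_cyclicGroup_iff hp).2 hu2⟩, Subtype.ext h4⟩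
  · refine ⟨⟨-u, (mem_cyclicGroup_iff hp).2 ?_⟩, Subtype.ext ?_⟩
    -- Since `2c` is even, `-u` is also a `2c`-th root of unity, so the sign ambiguity of the spinor
    -- is absorbed in the group.
    · rw [(even_two_mul c).neg_pow, hu2]
    · change ((-u : Circle) : ℂ) • (y : EuclideanSpace ℂ (Fin 2)) = y'
      rw [Circle.coe_neg, neg_smul]
      change -((u • y : S3) : EuclideanSpace ℂ (Fin 2)) = y'
      rw [h4, neg_neg]

/-- The bijection between the lens space and the space of null geodesics. -/
def lensToNull (hc : 1 ≤ c) : LensSpace (2 * c) → NullGeodesics c :=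
  Quotient.lift (fun y => nullGeodesic hc y 1) (by
    rintro y y' ⟨a, ha⟩
    have h1 : (a : Circle) ^ (2 * c) = 1 := (mem_cyclicGroup_iff (by omega)).1 a.2
    have h2 := nullGeodesic_smul hc (a : Circle) y' 1
    rw [h1, one_mul] at h2
    rw [← h2, ← ha]
    rfl)

theorem lensToNull_lensMk (hc : 1 ≤ c) (y : S3) :
    lensToNull hc (lensMk (2 * c) y) = nullGeodesic hc y 1 := rfl

theorem lensToNull_bijective (hc : 1 ≤ c) : Function.Bijective (lensToNull hc) := by
  constructor
  · intro q q' h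
    obtain ⟨y, rfl⟩ := lensMk_surjective _ q
    obtain ⟨y', rfl⟩ := lensMk_surjective _ q'
    obtain ⟨a, rfl⟩ := exists_smul_eq_of_nullGeodesic_eq hc h
    exact (lensMk_smul a y).symm
  · intro n
    obtain ⟨γ, J, hγ, hn⟩ := n.exists_geodesic
    obtain ⟨rfl, y, z, k, hk, rfl⟩ := eq_nullCurve_of_isMaximalNullGeodesic hc hγ
    -- Writing `z = u ^ (2c)` and moving along the geodesic by `u⁻¹` normalizes the circle component
    -- to `1`.
    obtain ⟨u, rfl⟩ := exists_pow_eq_circle (p := 2 * c) (by omega) z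
    refine ⟨lensMk _ (u⁻¹ • y), ?_⟩
    rw [lensToNull_lensMk, ← nullGeodesic_smul hc u, smul_inv_smul, mul_one]
    apply NullGeodesicSpace.ext
    rw [← hn, image_univ, range_nullCurve c _ _ hk]
    rfl

/-- The bijection between the lens space and the space of null geodesics. -/
def lensEquiv (hc : 1 ≤ c) : LensSpace (2 * c) ≃ NullGeodesics c :=
  Equiv.ofBijective _ (lensToNull_bijective hc)

theorem lensEquiv_lensMk (hc : 1 ≤ c) (y : S3) :
    lensEquiv hc (lensMk (2 * c) y) = nullGeodesic hc y 1 := rfl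

theorem lensEquiv_symm_nullGeodesic (hc : 1 ≤ c) (u : Circle) (y : S3) :
    (lensEquiv hc).symm (nullGeodesic hc (u • y) (u ^ (2 * c))) = lensMk (2 * c) y := by
  rw [Equiv.symm_apply_eq, lensEquiv_lensMk, ← nullGeodesic_smul hc u y 1, mul_one]

/-- The existence is stated for all tangent vectors, with the condition inside, so that choice
yields a map on the whole tangent bundle. -/
theorem exists_isTangentTo (hc : 1 ≤ c) (v : TangentBundle modelS2S1 (S2 × Circle)) :
    ∃ n : NullGeodesics c, v ∈ futureNullCone (spacetimeMetric c) timeField → IsTangentTo v n := by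
  by_cases hv : v ∈ futureNullCone (spacetimeMetric c) timeField
  · obtain ⟨y, z, k, hk, rfl⟩ := exists_eq_nullVector hc hv
    exact ⟨_, fun _ => isTangentTo_nullVector hc y z hk⟩
  · obtain ⟨y⟩ : Nonempty S3 := (NormedSpace.sphere_nonempty.2 zero_le_one).to_subtype
    exact ⟨nullGeodesic hc y 1, fun h => absurd h hv⟩

end Bijection

/-! ### Smoothness of the map from null vectors to the lens space -/

section Smoothness

/-- A map to the unit sphere is smooth if it is smooth as a map to the ambient space. -/
theorem contMDiffWithinAt_sphere_of_coe {V : Type*} [NormedAddCommGroup V] [InnerProductSpace ℝ V]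
    {n : ℕ} [Fact (Module.finrank ℝ V = n + 1)] {E H M : Type*} [NormedAddCommGroup E]
    [NormedSpace ℝ E] [TopologicalSpace H] {I : ModelWithCorners ℝ E H} [TopologicalSpace M]
    [ChartedSpace H M] {f : M → Metric.sphere (0 : V) 1} {s : Set M} {x : M}
    (hf : ContMDiffWithinAt I 𝓘(ℝ, V) ∞ (fun m => (f m : V)) s x) :
    ContMDiffWithinAt I (𝓡 n) ∞ f s x := by
  rw [contMDiffWithinAt_iff_target]
  refine ⟨Topology.IsInducing.subtypeVal.continuousWithinAt_iff.2 hf.continuousWithinAt, ?_⟩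
  let U := (OrthonormalBasis.fromOrthogonalSpanSingleton (𝕜 := ℝ) n
    (ne_zero_of_mem_unit_sphere (-f x))).repr
  -- The chart at `f x` is stereographic projection from `-f x`. Its formula makes sense on the
  -- ambient space and is smooth where the inner product with `-f x` is not `1`; at `f x` this
  -- product is `-1`.
  have h1 : ContDiffAt ℝ ∞ (fun w : V => U (stereoToFun (-f x : V) w)) (f x : V) := by
    refine U.contDiff.contDiffAt.comp _ ?_
    refine (contDiffOn_stereoToFun (n := ∞)).contDiffAt ?_
    refine IsOpen.mem_nhds ?_ ?_
    · exact isOpen_ne_fun (by fun_prop) continuous_const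
    · simp
      norm_num
  have h2 := h1.contMDiffAt.comp_contMDiffWithinAt x hf
  exact h2

/-- The embedding of the tangent bundle of `S² × S¹` is smooth. -/
theorem contMDiff_ambientVector : ContMDiff modelS2S1.tangent
    𝓘(ℝ, (EuclideanSpace ℝ (Fin 3) × ℂ) × (EuclideanSpace ℝ (Fin 3) × ℂ)) ∞ ambientVector := by
  refine ContMDiff.prodMk_space ?_ ?_
  · exact contMDiff_spacetimeEmbedding.comp (Bundle.contMDiff_proj _)
  · exact (contMDiff_snd_tangentBundle_modelSpace (EuclideanSpace ℝ (Fin 3) × ℂ)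
      𝓘(ℝ, EuclideanSpace ℝ (Fin 3) × ℂ)).comp
      (contMDiff_spacetimeEmbedding.contMDiff_tangentMap (m := ∞) (by simp))

theorem contMDiff_nullVector (c : ℕ) (z : Circle) (k : ℝ) :
    ContMDiff (𝓡 3) modelS2S1.tangent ∞ (fun y : S3 => nullVector c y z k) := by
  have hF := contMDiff_nullCurve_uncurry c z k
  have h1 : ContMDiff (𝓡 3) (𝓡 3).tangent ∞
      (fun y : S3 => (⟨y, 0⟩ : TangentBundle (𝓡 3) S3)) := Bundle.contMDiff_zeroSection ℝ _
  have h2 : ContMDiff (𝓡 3) 𝓘(ℝ, ℝ).tangent ∞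
      (fun _ : S3 => (⟨0, (1 : ℝ)⟩ : TangentBundle 𝓘(ℝ, ℝ) ℝ)) := contMDiff_const
  have h3 := (hF.contMDiff_tangentMap (m := ∞) (by simp)).comp
    -- The initial velocity is the tangent map of `(y, s) ↦ nullCurve c y z k s` applied to the
    -- vector `(0, 1)` at `(y, 0)`.
    ((contMDiff_equivTangentBundleProd_symm (n := ∞) (I := 𝓡 3) (M := S3) (I' := 𝓘(ℝ, ℝ))
      (M' := ℝ)).comp
      (h1.prodMk h2))
  refine h3.congr fun y => ?_
  have h4 := mfderiv_comp (I := 𝓘(ℝ, ℝ)) (I' := (𝓡 3).prod 𝓘(ℝ, ℝ)) (I'' := modelS2S1)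
    (f := fun s : ℝ => ((y, s) : S3 × ℝ)) (0 : ℝ) (hF.mdifferentiable (by simp) (y, 0))
    (mdifferentiableAt_const.prodMk mdifferentiableAt_id)
  rw [mfderiv_prod_right] at h4
  exact congrArg (fun T =>
    (⟨nullCurve c y z k 0, T (1 : ℝ)⟩ : TangentBundle modelS2S1 (S2 × Circle)))
    h4

/-- The speed of a null vector, in terms of the ambient space. -/
def ambientSpeed (c : ℕ)
    (a : (EuclideanSpace ℝ (Fin 3) × ℂ) × (EuclideanSpace ℝ (Fin 3) × ℂ)) : ℝ :=
  ⟪Complex.I * a.1.2, a.2.2⟫_ℝ / c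

/-- The isotropic vector of the frame of a null vector, in terms of the ambient space. -/
def ambientIsotropic (c : ℕ) (a : (EuclideanSpace ℝ (Fin 3) × ℂ) × (EuclideanSpace ℝ (Fin 3) × ℂ))
    (i : Fin 3) : ℂ :=
  (a.1.1 i : ℂ) - Complex.I * ((a.2.1 i / ambientSpeed c a : ℝ) : ℂ)

/-- The product of the spinor of a null vector with its hermitian product with `y₀`. -/
def ambientSpinor (c : ℕ) (y₀ : S3)
    (a : (EuclideanSpace ℝ (Fin 3) × ℂ) × (EuclideanSpace ℝ (Fin 3) × ℂ)) :
    EuclideanSpace ℂ (Fin 2) :=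
  WithLp.toLp 2 fun i => ∑ j, spinorSquare (ambientIsotropic c a) i j
    * (starRingEnd ℂ) ((y₀ : EuclideanSpace ℂ (Fin 2)) j)

/-- The function whose `2c`-th root is used to normalize a spinor. -/
def ambientPhase (c : ℕ) (y₀ : S3) (u₀ : Circle)
    (a : (EuclideanSpace ℝ (Fin 3) × ℂ) × (EuclideanSpace ℝ (Fin 3) × ℂ)) : ℂ :=
  a.1.2 * (∑ i, (starRingEnd ℂ) ((y₀ : EuclideanSpace ℂ (Fin 2)) i) * ambientSpinor c y₀ a i) ^ c
    / (u₀ : ℂ) ^ (2 * c)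

/-- The normalized spinor of the null geodesic of a null vector near `nullVector c y₀ (u₀ ^ (2c))`,
in terms of the ambient space. -/
def ambientLift (c : ℕ) (y₀ : S3) (u₀ : Circle)
    (a : (EuclideanSpace ℝ (Fin 3) × ℂ) × (EuclideanSpace ℝ (Fin 3) × ℂ)) :
    EuclideanSpace ℂ (Fin 2) :=
  ((u₀ : ℂ)⁻¹ * Complex.exp (-Complex.log (ambientPhase c y₀ u₀ a) / (2 * c)))
    • ambientSpinor c y₀ a

variable {c : ℕ}

theorem ambientSpeed_nullVector (hc : 1 ≤ c) (y : S3) (z : Circle) (k : ℝ) :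
    ambientSpeed c (ambientVector (nullVector c y z k)) = k := by
  have hc' : (0 : ℝ) < c := by exact_mod_cast hc
  rw [ambientVector_nullVector, ambientSpeed]
  simp only
  rw [inner_smul_right, real_inner_self_eq_norm_sq, norm_mul, Complex.norm_I, Circle.norm_coe]
  field_simp

theorem ambientIsotropic_nullVector (hc : 1 ≤ c) (y : S3) (z : Circle) {k : ℝ} (hk : 0 < k) :
    ambientIsotropic c (ambientVector (nullVector c y z k)) = isotropicVector y := by
  funext i
  rw [ambientIsotropic, ambientSpeed_nullVector hc, ambientVector_nullVector, isotropicVector_eq]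
  have hk0 : k ≠ 0 := hk.ne'
  simp [hk0]

/-- The hermitian product of two spinors. -/
def hermitianProduct (y₀ y : S3) : ℂ :=
  ∑ j, (y : EuclideanSpace ℂ (Fin 2)) j * (starRingEnd ℂ) ((y₀ : EuclideanSpace ℂ (Fin 2)) j)

theorem hermitianProduct_self (y : S3) : hermitianProduct y y = 1 := by
  have h := norm_sq_eq_re_im y
  rw [norm_eq_of_mem_sphere] at h
  rw [hermitianProduct, Fin.sum_univ_two, Complex.mul_conj, Complex.mul_conj, Complex.normSq_apply,
    Complex.normSq_apply, ← Complex.ofReal_add]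
  norm_cast
  linarith

/-- The multiple of `y` by its hermitian product with `y₀` is quadratic in `y`, so it is insensitive
to the sign of `y` and is a function of the frame. -/
theorem ambientSpinor_nullVector (hc : 1 ≤ c) (y₀ y : S3) (z : Circle) {k : ℝ} (hk : 0 < k) :
    ambientSpinor c y₀ (ambientVector (nullVector c y z k))
      = hermitianProduct y₀ y • (y : EuclideanSpace ℂ (Fin 2)) := by
  ext i
  simp only [ambientSpinor, ambientIsotropic_nullVector hc y z hk, spinorSquare_isotropicVector,
    PiLp.smul_apply, smul_eq_mul, hermitianProduct, Finset.sum_mul]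
  exact Finset.sum_congr rfl fun j _ => by ring

/-- Let `h` be the hermitian product. If `z = w ^ (2c)`, this is the `2c`-th power of `w h / u₀`.
Multiplying `h y` by `u₀⁻¹` and an inverse `2c`-th root of the phase therefore gives `w⁻¹ y` up to a
`2c`-th root of unity, which represents the geodesic in the lens space. -/
theorem ambientPhase_nullVector (hc : 1 ≤ c) (y₀ : S3) (u₀ : Circle) (y : S3) (z : Circle) {k : ℝ}
    (hk : 0 < k) : ambientPhase c y₀ u₀ (ambientVector (nullVector c y z k))
      = z * hermitianProduct y₀ y ^ (2 * c) / (u₀ : ℂ) ^ (2 * c) := by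
  rw [ambientPhase, ambientSpinor_nullVector hc y₀ y z hk, ambientVector_nullVector]
  congr 2
  rw [pow_mul, sq]
  congr 1
  simp only [PiLp.smul_apply, smul_eq_mul]
  conv_rhs => rw [hermitianProduct, Finset.sum_mul]
  exact Finset.sum_congr rfl fun j _ => by rw [hermitianProduct]; ring

/-- The lift represents the null geodesic to which the null vector is tangent. -/
theorem exists_coe_eq_ambientLift (hc : 1 ≤ c) (y₀ : S3) (u₀ : Circle) (y : S3) (z : Circle) {k : ℝ}
    (hk : 0 < k) (h : ambientPhase c y₀ u₀ (ambientVector (nullVector c y z k)) ≠ 0) :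
    ∃ s : S3, (s : EuclideanSpace ℂ (Fin 2))
        = ambientLift c y₀ u₀ (ambientVector (nullVector c y z k)) ∧
      lensMk (2 * c) s = (lensEquiv hc).symm (nullGeodesic hc y z) := by
  have hp : 2 * c ≠ 0 := by omega
  have hp' : (2 * c : ℂ) ≠ 0 := by exact_mod_cast hp
  obtain ⟨u, rfl⟩ := exists_pow_eq_circle hp z
  obtain ⟨y, rfl⟩ : ∃ y₁, y = u • y₁ := ⟨u⁻¹ • y, (smul_inv_smul u y).symm⟩
  rw [lensEquiv_symm_nullGeodesic]
  set R := ambientPhase c y₀ u₀ (ambientVector (nullVector c (u • y) (u ^ (2 * c)) k)) with hR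
  -- The lift is `b • y` for the normalized spinor `y`. Whatever the branch of the logarithm, `b ^
  -- (2c) = 1`, so the lift lies in the orbit of `y`.
  set b : ℂ := (u₀ : ℂ)⁻¹ * Complex.exp (-Complex.log R / (2 * c)) * hermitianProduct y₀ (u • y) * u
    with hb
  have hexp : Complex.exp (-Complex.log R / (2 * c)) ^ (2 * c) = R⁻¹ := by
    rw [← Complex.exp_nat_mul]
    push_cast
    rw [mul_div_cancel₀ _ hp', Complex.exp_neg, Complex.exp_log h]
  have hRe : R = u ^ (2 * c) * hermitianProduct y₀ (u • y) ^ (2 * c) / (u₀ : ℂ) ^ (2 * c) := by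
    rw [hR, ambientPhase_nullVector hc y₀ u₀ _ _ hk, Circle.coe_pow]
  have hbp : b ^ (2 * c) = 1 := by
    have h1 : b ^ (2 * c) = R⁻¹ * R := by
      calc b ^ (2 * c) = R⁻¹ * (u ^ (2 * c) * hermitianProduct y₀ (u • y) ^ (2 * c)
            / (u₀ : ℂ) ^ (2 * c)) := by
            rw [hb, mul_pow, mul_pow, mul_pow, hexp]
            ring
        _ = R⁻¹ * R := by rw [← hRe]
    rw [h1, inv_mul_cancel₀ h]
  have hbn : ‖b‖ = 1 := by
    refine (pow_eq_one_iff_of_nonneg (norm_nonneg b) hp).1 ?_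
    rw [← norm_pow, hbp, norm_one]
  obtain ⟨a, ha⟩ : ∃ a : Circle, (a : ℂ) = b := ⟨⟨b, mem_sphere_zero_iff_norm.2 hbn⟩, rfl⟩
  have hamem : a ∈ cyclicGroup (2 * c) := by
    rw [mem_cyclicGroup_iff hp]
    apply Circle.ext
    rw [Circle.coe_pow, ha, hbp, Circle.coe_one]
  refine ⟨a • y, ?_, lensMk_smul (⟨a, hamem⟩ : cyclicGroup (2 * c)) y⟩
  rw [ambientLift, ambientSpinor_nullVector hc y₀ _ _ hk, coe_circle_smul_S3,
    coe_circle_smul_S3, ha,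
    ← hR, smul_smul, smul_smul, hb]

theorem contDiffAt_ambientSpinor (hc : 1 ≤ c) (y₀ : S3) (y : S3) (z : Circle) {k : ℝ}
    (hk : 0 < k) :
    ContDiffAt ℝ ∞ (ambientSpinor c y₀) (ambientVector (nullVector c y z k)) := by
  have hspeed : ContDiff ℝ ∞ (ambientSpeed c) := by
    unfold ambientSpeed
    exact (ContDiff.inner ℝ (contDiff_const.mul (contDiff_snd.comp contDiff_fst))
      (contDiff_snd.comp contDiff_snd)).div_const _
  have hiso : ∀ i, ContDiffAt ℝ ∞ (fun a => ambientIsotropic c a i)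
      (ambientVector (nullVector c y z k)) := fun i => by
    have hcoord : ContDiff ℝ ∞ (fun x : EuclideanSpace ℝ (Fin 3) => x i) :=
      contDiff_piLp_apply (p := 2) (𝕜 := ℝ) (i := i)
    unfold ambientIsotropic
    refine ContDiffAt.sub ?_ (contDiffAt_const.mul ?_)
    · exact (Complex.ofRealCLM.contDiff.comp
        (hcoord.comp (contDiff_fst.comp contDiff_fst))).contDiffAt
    · refine Complex.ofRealCLM.contDiff.contDiffAt.comp _ ?_
      exact (hcoord.comp (contDiff_fst.comp contDiff_snd)).contDiffAt.div hspeed.contDiffAt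
        (by rw [ambientSpeed_nullVector hc]; exact hk.ne')
  have hsq : ∀ i j, ContDiffAt ℝ ∞ (fun a => spinorSquare (ambientIsotropic c a) i j)
      (ambientVector (nullVector c y z k)) := fun i j => by
    fin_cases i <;> fin_cases j
    · exact ((hiso 0).sub (contDiffAt_const.mul (hiso 1))).div_const _
    · exact (hiso 2).neg.div_const _
    · exact (hiso 2).neg.div_const _
    · exact ((hiso 0).neg.sub (contDiffAt_const.mul (hiso 1))).div_const _
  rw [contDiffAt_piLp]
  exact fun i => ContDiffAt.sum (s := Finset.univ)
    (f := fun j a => spinorSquare (ambientIsotropic c a) i j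
      * (starRingEnd ℂ) ((y₀ : EuclideanSpace ℂ (Fin 2)) j))
    fun j _ => (hsq i j).mul contDiffAt_const

theorem ambientPhase_nullVector_self (hc : 1 ≤ c) (y₀ : S3) (u₀ : Circle) {k : ℝ} (hk : 0 < k) :
    ambientPhase c y₀ u₀ (ambientVector (nullVector c y₀ (u₀ ^ (2 * c)) k)) = 1 := by
  rw [ambientPhase_nullVector hc y₀ u₀ _ _ hk, hermitianProduct_self, one_pow, mul_one,
    Circle.coe_pow, div_self]
  exact pow_ne_zero _ u₀.coe_ne_zero

theorem contDiffAt_ambientPhase (hc : 1 ≤ c) (y₀ : S3) (u₀ : Circle) {k : ℝ} (hk : 0 < k) :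
    ContDiffAt ℝ ∞ (ambientPhase c y₀ u₀)
      (ambientVector (nullVector c y₀ (u₀ ^ (2 * c)) k)) := by
  have h := (contDiffAt_piLp 2).1 (contDiffAt_ambientSpinor hc y₀ y₀ (u₀ ^ (2 * c)) hk)
  unfold ambientPhase
  refine ContDiffAt.div_const (ContDiffAt.mul ?_ (ContDiffAt.pow ?_ c)) _
  · exact (contDiff_snd.comp contDiff_fst).contDiffAt
  · exact ContDiffAt.sum fun i _ => contDiffAt_const.mul (h i)

theorem contDiffAt_ambientLift (hc : 1 ≤ c) (y₀ : S3) (u₀ : Circle) {k : ℝ} (hk : 0 < k) :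
    ContDiffAt ℝ ∞ (ambientLift c y₀ u₀)
      (ambientVector (nullVector c y₀ (u₀ ^ (2 * c)) k)) := by
  have hlog : ContDiffAt ℝ ∞ Complex.log
      (ambientPhase c y₀ u₀ (ambientVector (nullVector c y₀ (u₀ ^ (2 * c)) k))) := by
    -- The phase is normalized to be `1` at the base vector, away from the cut of the principal
    -- logarithm.
    rw [ambientPhase_nullVector_self hc y₀ u₀ hk]
    exact (Complex.contDiffAt_log Complex.one_mem_slitPlane).restrict_scalars ℝ
  have hexp : ContDiffAt ℝ ∞ (fun a => (u₀ : ℂ)⁻¹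
      * Complex.exp (-Complex.log (ambientPhase c y₀ u₀ a) / (2 * c)))
      (ambientVector (nullVector c y₀ (u₀ ^ (2 * c)) k)) := by
    refine contDiffAt_const.mul (ContDiffAt.cexp ?_)
    exact (hlog.comp _ (contDiffAt_ambientPhase hc y₀ u₀ hk)).neg.div_const _
  exact hexp.smul (contDiffAt_ambientSpinor hc y₀ _ _ hk)

/-- The map that sends a null vector to the point of the lens space is smooth. -/
theorem contMDiffOn_lensEquiv_symm_comp (hc : 1 ≤ c)
    {π : TangentBundle modelS2S1 (S2 × Circle) → NullGeodesics c}
    (hπ : ∀ v ∈ futureNullCone (spacetimeMetric c) timeField, IsTangentTo v (π v)) :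
    ContMDiffOn modelS2S1.tangent (𝓡 3) ∞ ((lensEquiv hc).symm ∘ π)
      (futureNullCone (spacetimeMetric c) timeField) := by
  intro v₀ hv₀
  obtain ⟨y₀, z₀, k₀, hk₀, rfl⟩ := exists_eq_nullVector hc hv₀
  obtain ⟨u₀, rfl⟩ := exists_pow_eq_circle (p := 2 * c) (by omega) z₀
  have hev : ∀ᶠ v in 𝓝[futureNullCone (spacetimeMetric c) timeField]
      (nullVector c y₀ (u₀ ^ (2 * c)) k₀), ∃ s : S3, (s : EuclideanSpace ℂ (Fin 2))
        = ambientLift c y₀ u₀ (ambientVector v) ∧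
      lensMk (2 * c) s = (lensEquiv hc).symm (π v) := by
    have h1 : ∀ᶠ v in 𝓝 (nullVector c y₀ (u₀ ^ (2 * c)) k₀),
        ambientPhase c y₀ u₀ (ambientVector v) ≠ 0 := by
      have h2 : ContinuousAt (fun v => ambientPhase c y₀ u₀ (ambientVector v))
          (nullVector c y₀ (u₀ ^ (2 * c)) k₀) :=
        ContinuousAt.comp (f := ambientVector) (contDiffAt_ambientPhase hc y₀ u₀ hk₀).continuousAt
          contMDiff_ambientVector.continuous.continuousAt
      refine h2.eventually_ne ?_
      rw [ambientPhase_nullVector_self hc y₀ u₀ hk₀]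
      exact one_ne_zero
    filter_upwards [mem_nhdsWithin_of_mem_nhds h1, self_mem_nhdsWithin] with v hv hvC
    obtain ⟨y, z, k, hk, rfl⟩ := exists_eq_nullVector hc hvC
    rw [isTangentTo_unique hc (hπ _ hvC) (isTangentTo_nullVector hc y z hk)]
    exact exists_coe_eq_ambientLift hc y₀ u₀ y z hk hv
  classical
  -- The ambient lift is a point of `S³` only for suitable vectors. The default value `y₀` is
  -- harmless, since near the base vector every vector of `C⁺` falls in the first case.
  let s : TangentBundle modelS2S1 (S2 × Circle) → S3 := fun v =>
    if h : ∃ s : S3, (s : EuclideanSpace ℂ (Fin 2)) = ambientLift c y₀ u₀ (ambientVector v) ∧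
      lensMk (2 * c) s = (lensEquiv hc).symm (π v) then h.choose else y₀
  have hs : ∀ v, (∃ s : S3, (s : EuclideanSpace ℂ (Fin 2)) = ambientLift c y₀ u₀ (ambientVector v) ∧
      lensMk (2 * c) s = (lensEquiv hc).symm (π v)) →
      (s v : EuclideanSpace ℂ (Fin 2)) = ambientLift c y₀ u₀ (ambientVector v) ∧
      lensMk (2 * c) (s v) = (lensEquiv hc).symm (π v) := fun v h => by
    simp only [s, dif_pos h]
    exact h.choose_spec
  have hsm : ContMDiffWithinAt modelS2S1.tangent (𝓡 3) ∞ s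
      (futureNullCone (spacetimeMetric c) timeField) (nullVector c y₀ (u₀ ^ (2 * c)) k₀) := by
    apply contMDiffWithinAt_sphere_of_coe (n := 3)
    have h3 : ContMDiffAt modelS2S1.tangent 𝓘(ℝ, EuclideanSpace ℂ (Fin 2)) ∞
        (ambientLift c y₀ u₀ ∘ ambientVector) (nullVector c y₀ (u₀ ^ (2 * c)) k₀) :=
      (contDiffAt_ambientLift hc y₀ u₀ hk₀).contMDiffAt.comp _ contMDiff_ambientVector.contMDiffAt
    refine h3.contMDiffWithinAt.congr_of_eventuallyEq ?_ (hs _ (hev.self_of_nhdsWithin hv₀)).1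
    filter_upwards [hev] with v hv using (hs v hv).1
  refine ((contMDiff_lensMk (2 * c)).contMDiffAt.comp_contMDiffWithinAt _ hsm).congr_of_eventuallyEq
    ?_ (hs _ (hev.self_of_nhdsWithin hv₀)).2.symm
  filter_upwards [hev] with v hv using (hs v hv).2.symm

end Smoothness

/-! ### Transport of a manifold structure along a homeomorphism -/

section Transport

variable {H M N : Type*} [TopologicalSpace H] [TopologicalSpace M] [ChartedSpace H M]
  [TopologicalSpace N]

/-- The charts of `M`, transported by a homeomorphism `M ≃ₜ N`. -/
abbrev transportedChartedSpace (h : M ≃ₜ N) : ChartedSpace H N where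
  atlas := (fun e => h.symm.toOpenPartialHomeomorph.trans e) '' atlas H M
  chartAt q := h.symm.toOpenPartialHomeomorph.trans (chartAt H (h.symm q))
  mem_chart_source q := by simp
  chart_mem_atlas q := ⟨_, chart_mem_atlas H _, rfl⟩

variable {E : Type*} [NormedAddCommGroup E] [NormedSpace ℝ E] (I : ModelWithCorners ℝ E H)

theorem isManifold_transported (h : M ≃ₜ N) [IsManifold I ∞ M] :
    @IsManifold _ _ _ _ _ _ _ I ∞ N _ (transportedChartedSpace h) := by
  let _ : ChartedSpace H N := transportedChartedSpace h
  have : HasGroupoid N (contDiffGroupoid ∞ I) := by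
    constructor
    rintro _ _ ⟨e, he, rfl⟩ ⟨e', he', rfl⟩
    -- The homeomorphism cancels in a change of charts, leaving the change of charts of `M`.
    refine (contDiffGroupoid ∞ I).mem_of_eqOnSource
      (HasGroupoid.compatible (G := contDiffGroupoid ∞ I) he he') ⟨?_, fun x _ => ?_⟩
    · ext x
      simp
    · simp
  exact IsManifold.mk' I ∞ N

theorem contMDiff_transported (h : M ≃ₜ N) [IsManifold I ∞ M] :
    @ContMDiff _ _ _ _ _ _ _ I M _ _ _ _ _ _ _ I N _ (transportedChartedSpace h) ∞ h := by
  let _ : ChartedSpace H N := transportedChartedSpace h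
  have := isManifold_transported I h
  intro x
  have hchart : chartAt H (h x) = h.symm.toOpenPartialHomeomorph.trans (chartAt H x) := by
    change h.symm.toOpenPartialHomeomorph.trans (chartAt H (h.symm (h x))) = _
    rw [h.symm_apply_apply]
  have h1 : ContMDiffOn I I ∞ ((chartAt H (h x)).symm ∘ chartAt H x) (chartAt H x).source := by
    refine (contMDiffOn_chart_symm (I := I) (n := ∞)).comp contMDiffOn_chart fun n hn => ?_
    rw [hchart]
    simpa using (chartAt H x).map_source hn
  refine (h1.contMDiffAt (chart_source_mem_nhds H x)).congr_of_eventuallyEq ?_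
  filter_upwards [chart_source_mem_nhds H x] with n hn
  rw [hchart]
  simp [hn]

theorem contMDiff_transported_symm (h : M ≃ₜ N) [IsManifold I ∞ M] :
    @ContMDiff _ _ _ _ _ _ _ I N _ (transportedChartedSpace h) _ _ _ _ _ I M _ _ ∞ h.symm := by
  let _ : ChartedSpace H N := transportedChartedSpace h
  have := isManifold_transported I h
  intro q
  obtain ⟨x, rfl⟩ := h.surjective q
  have hchart : chartAt H (h x) = h.symm.toOpenPartialHomeomorph.trans (chartAt H x) := by
    change h.symm.toOpenPartialHomeomorph.trans (chartAt H (h.symm (h x))) = _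
    rw [h.symm_apply_apply]
  have hsrc : ∀ n ∈ (chartAt H (h x)).source, h.symm n ∈ (chartAt H x).source := fun n hn => by
    rw [hchart] at hn
    simpa using hn
  have h1 : ContMDiffOn I I ∞ ((chartAt H x).symm ∘ chartAt H (h x)) (chartAt H (h x)).source := by
    refine (contMDiffOn_chart_symm (I := I) (n := ∞)).comp contMDiffOn_chart fun n hn => ?_
    rw [hchart]
    simpa using (chartAt H x).map_source (hsrc n hn)
  refine (h1.contMDiffAt (chart_source_mem_nhds H (h x))).congr_of_eventuallyEq ?_
  filter_upwards [chart_source_mem_nhds H (h x)] with n hn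
  have h2 := (chartAt H x).left_inv (hsrc n hn)
  rw [hchart]
  simpa using h2.symm

end Transport

/-! ### The quotient structure and its uniqueness -/

section Main

variable {c : ℕ}

/-- A quotient manifold structure on the space of null geodesics is diffeomorphic to the
lens space. -/
theorem nonempty_diffeomorph_lensSpace (hc : 1 ≤ c) [TopologicalSpace (NullGeodesics c)]
    [ChartedSpace (EuclideanSpace ℝ (Fin 3)) (NullGeodesics c)]
    (h : IsNullGeodesicManifold (spacetimeMetric c) timeField (F := EuclideanSpace ℝ (Fin 3))) :
    Nonempty (NullGeodesics c ≃ₘ^∞⟮𝓡 3, 𝓡 3⟯ LensSpace (2 * c)) := by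
  obtain ⟨π, hπ, hsm, hsec⟩ := h.exists_submersion
  have hπ' : ∀ y : S3, π (nullVector c y 1 1) = nullGeodesic hc y 1 := fun y =>
    isTangentTo_unique hc (hπ _ (nullVector_mem hc y 1 one_pos))
      (isTangentTo_nullVector hc y 1 one_pos)
  refine ⟨⟨(lensEquiv hc).symm, ?_, ?_⟩⟩
  · intro n
    obtain ⟨q, rfl⟩ := (lensEquiv hc).surjective n
    obtain ⟨y, rfl⟩ := lensMk_surjective _ q
    rw [lensEquiv_lensMk, ← hπ' y]
    -- On `U` the map `(lensEquiv hc).symm` equals its composite with `π ∘ σ`, and it is smooth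
    -- after composition with `π`.
    obtain ⟨U, σ, hU, hmem, hσ, -, hσπ⟩ := hsec _ (nullVector_mem hc y 1 one_pos)
    have h1 := (contMDiffOn_lensEquiv_symm_comp hc hπ).comp hσ fun n hn => (hσπ n hn).1
    refine (h1.contMDiffAt (hU.mem_nhds hmem)).congr_of_eventuallyEq ?_
    filter_upwards [hU.mem_nhds hmem] with n hn
    simp [(hσπ n hn).2]
  -- Pulled back to `S³`, the inverse is `π` applied to the smooth family `nullVector c y 1 1`.
  · refine contMDiff_of_comp_lensMk ?_
    have h1 := hsm.comp_contMDiff (contMDiff_nullVector c 1 1)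
      fun y => nullVector_mem hc y 1 one_pos
    exact h1.congr fun y => (hπ' y).symm

/-- The space of null geodesics is a quotient manifold of the future null cone. -/
theorem exists_isNullGeodesicManifold (hc : 1 ≤ c) :
    ∃ (_ : TopologicalSpace (NullGeodesics c))
      (_ : ChartedSpace (EuclideanSpace ℝ (Fin 3)) (NullGeodesics c)),
      IsNullGeodesicManifold (spacetimeMetric c) timeField (F := EuclideanSpace ℝ (Fin 3)) := by
  let t : TopologicalSpace (NullGeodesics c) := .induced (lensEquiv hc).symm inferInstance
  let h : LensSpace (2 * c) ≃ₜ NullGeodesics c :=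
    ((lensEquiv hc).symm.toHomeomorphOfIsInducing ⟨rfl⟩).symm
  let _ : ChartedSpace (EuclideanSpace ℝ (Fin 3)) (NullGeodesics c) := transportedChartedSpace h
  have hsecond := secondCountableTopology_lensSpace (2 * c)
  have hh : ContMDiff (𝓡 3) (𝓡 3) ∞ h := contMDiff_transported (𝓡 3) h
  have hh' : ContMDiff (𝓡 3) (𝓡 3) ∞ h.symm := contMDiff_transported_symm (𝓡 3) h
  refine ⟨t, inferInstance, isManifold_transported (𝓡 3) h, h.t2Space,
    h.symm.secondCountableTopology, ?_⟩
  choose π hπ using exists_isTangentTo (c := c) hc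
  refine ⟨π, hπ, ?_, fun v hv => ?_⟩
  · refine (hh.comp_contMDiffOn (contMDiffOn_lensEquiv_symm_comp hc hπ)).congr fun v _ => ?_
    exact ((lensEquiv hc).apply_symm_apply (π v)).symm
  · obtain ⟨y, z, k, hk, rfl⟩ := exists_eq_nullVector hc hv
    obtain ⟨u, rfl⟩ := exists_pow_eq_circle (p := 2 * c) (by omega) z
    obtain ⟨y, rfl⟩ : ∃ y₁, y = u • y₁ := ⟨u⁻¹ • y, (smul_inv_smul u y).symm⟩
    obtain ⟨U, ℓ, hU, hyU, hℓ, hℓy, hsec⟩ := exists_section_lensMk (2 * c) y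
    have hπ' : ∀ y : S3, π (nullVector c (u • y) (u ^ (2 * c)) k) = h (lensMk (2 * c) y) := by
      intro y
      rw [isTangentTo_unique hc (hπ _ (nullVector_mem hc (u • y) (u ^ (2 * c)) hk))
        (isTangentTo_nullVector hc _ _ hk)]
      exact (Equiv.symm_apply_eq _).1 (lensEquiv_symm_nullGeodesic hc u y)
    -- A section of the covering gives a normalized spinor. It is then moved along the geodesic by
    -- the fixed `u` and given the fixed speed `k`, so that the section passes through the
    -- prescribed vector.
    refine ⟨h.symm ⁻¹' U, fun n => nullVector c (u • ℓ (h.symm n)) (u ^ (2 * c)) k,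
      hU.preimage h.symm.continuous, ?_, ?_, ?_, fun n hn => ⟨nullVector_mem hc _ _ hk, ?_⟩⟩
    · rw [hπ', mem_preimage, h.symm_apply_apply]
      exact hyU
    · exact (contMDiff_nullVector c (u ^ (2 * c)) k).comp_contMDiffOn
        ((contMDiff_smul_S3 u).comp_contMDiffOn
          (hℓ.comp hh'.contMDiffOn (fun n hn => hn)))
    · simp only [hπ', h.symm_apply_apply, hℓy]
    · rw [hπ', hsec _ hn, h.apply_symm_apply]

end Main

end

theorem theorem3p5 (c : ℕ) (hc : 1 ≤ c) :
    (∃ (_ : TopologicalSpace (NullGeodesics c))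
        (_ : ChartedSpace (EuclideanSpace ℝ (Fin 3)) (NullGeodesics c)),
      IsNullGeodesicManifold (spacetimeMetric c) timeField (F := EuclideanSpace ℝ (Fin 3))) ∧
    ∀ (_ : TopologicalSpace (NullGeodesics c))
      (_ : ChartedSpace (EuclideanSpace ℝ (Fin 3)) (NullGeodesics c)),
      IsNullGeodesicManifold (spacetimeMetric c) timeField (F := EuclideanSpace ℝ (Fin 3)) →
      Nonempty (NullGeodesics c ≃ₘ^∞⟮𝓡 3, 𝓡 3⟯ LensSpace (2 * c)) :=
  ⟨exists_isNullGeodesicManifold hc, fun _ _ h => nonempty_diffeomorph_lensSpace hc h⟩
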